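/- **Setting.** Graphs are finite, simple, undirected and connected; $d$ is the graph distance and $I(u,v)=\{x: d(u,x)+d(x,v)=d(u,v)\}$. A graph is median if $I(x,y)\cap I(y,z)\cap I(z,x)$ is a singleton for all distinct $x,y,z$. For $\omega:V\to\mathbb N$ put $d_\omega(u,v)=d(u,v)+\omega(v)$ and $\mathrm{ecc}(u,(G,\omega))=\max_v d_\omega(u,v)$. The Θ-classes of $G$ are the classes of edges under the reflexive transitive closure of the relation "opposite edges of a square"; the halfspaces of a Θ-class $E$ are the vertex sets of the two components of $G\setminus E$. With $n=|V(G)|$, $E$ is $(2\log)$-balanced if both its halfspaces have at least $n/(2\log n)$ vertices ($\log$ is the natural logarithm). Let $(G,\omega)$ be a weighted median graph with $n\ge 3$ vertices and no $(2\log)$-balanced Θ-class. Let $v_0$ be its (unique) median vertex, i.e. the minimizer of $u\mapsto\sum_v d(u,v)$, and let $u_{\max}$ satisfy $d_\omega(v_0,u_{\max})=\mathrm{ecc}(v_0,(G,\omega))$, with $u_{\max}=v_0$ whenever $v_0$ satisfies this itself. Assume $u_{\max}\ne v_0$. Let $E_1,\dots,E_\ell$ be any enumeration without repetition of the Θ-classes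 that have an edge incident with $v_0$ and separate $v_0$ from $u_{\max}$, and let $H_j'$ be the smaller halfspace of $E_j$. Put $G_0=G$, $G_{i+1}=G_i\setminus H_{i+1}'$ (induced subgraphs) and let $S_i$ be the subgraph induced by $V(G_i)\setminus V(G_{i+1})$, for $0\le i\le \ell-1$. If $x\in V(S_i)$ has a neighbour in $V(G_{i+1})$, let $\omega_i^*(x)$ be the maximum of $d_\omega(x,z)$ in $G_i$ over the vertices $z\neq x$ of $G_i$ whose gate in $S_i$ is $x$ (the $S_i$-gate of $z$ is the vertex of $S_i$ that lies in $I(z,y)$ for every $y\in V(S_i)$); otherwise $\omega_i^*(x)=\omega(x)$. For $u\in V(S_i)\cup\dots\cup V(S_{\ell-1})$ let $\mathcal B_i(u)=\mathrm{ecc}(u,(G_i,\omega))$; $\mathcal B_\ell$ is the empty labeling. **Theorem.** (1) There is an algorithm (one program and one constant in the bounds, for all inputs) that, for every such $(G,\omega)$, $v_0$, $u_{\max}$, $E_1,\dots,E_\ell$ and every $0\le i\le\ell-1$, given adjacency lists of $G_i$, the weights, the partition of $V(G_i)$ into $V(S_i),\dots,V(S_{\ell-1}),V(G_\ell)$, all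 weighted eccentricities of $(S_i,\omega)$ and of $(S_i,\omega_i^*)$, and all labels of $\mathcal B_{i+1}$, computes all labels of $\mathcal B_i$ in time $O(|E(G_i)|)$. (2) There is an algorithm that, for every such $(G,\omega)$, $v_0$, $u_{\max}$, $E_1,\dots,E_\ell$, given adjacency lists of $G$, the weights, the partition of $V(G)$ into $V(S_0),\dots,V(S_{\ell-1}),V(G_\ell)$, and all weighted eccentricities of $(S_i,\omega)$ and of $(S_i,\omega_i^*)$ for $0\le i\le\ell-1$, computes all weighted eccentricities of $(G,\omega)$ in time $O(n\log^2 n)$. Time is counted on a random access machine with unit-cost comparison, addition, subtraction and array access, all of whose written numbers are $O(|V(G)|+|E(G)|+\max\omega)$. -/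

import Mathlib

/-! ## Median graphs, Theta-classes, weighted eccentricities -/

namespace MedianEcc

universe u

variable {V : Type u}

/-- The interval `I(u,v)`. -/
def interval (G : SimpleGraph V) (u v : V) : Set V :=
  {x | G.dist u x + G.dist x v = G.dist u v}

/-- Median graphs: connected graphs in which every triple of distinct vertices has exactly one
median. -/
def IsMedianGraph (G : SimpleGraph V) : Prop :=
  G.Connected ∧ ∀ x y z : V, x ≠ y → y ≠ z → z ≠ x →
    ∃! m : V, m ∈ interval G x y ∩ interval G y z ∩ interval G z x

/-- `e` and `f` are opposite edges of a square `u v y x`. -/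
def SquareOpposite (G : SimpleGraph V) (e f : Sym2 V) : Prop :=
  ∃ u v x y : V, e = s(u, v) ∧ f = s(x, y) ∧
    G.Adj u v ∧ G.Adj v y ∧ G.Adj y x ∧ G.Adj x u ∧ u ≠ y ∧ v ≠ x

/-- The Theta-classes: the classes of edges under the reflexive transitive closure of
`SquareOpposite`. -/
def IsThetaClass (G : SimpleGraph V) (E : Set (Sym2 V)) : Prop :=
  ∃ e ∈ G.edgeSet, E = {f | Relation.ReflTransGen (SquareOpposite G) e f}

/-- The side of `x` with respect to `E`: the connected component of `x` in `G` deprived of the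
edges of `E`. -/
def side (G : SimpleGraph V) (E : Set (Sym2 V)) (x : V) : Set V :=
  {y | (G.deleteEdges E).Reachable x y}

/-- The halfspaces of `E`: the vertex sets of the connected components of `G` deprived of the
edges of `E` (two of them if `E` is a Theta-class of a median graph). -/
def IsHalfspace (G : SimpleGraph V) (E : Set (Sym2 V)) (H : Set V) : Prop :=
  ∃ x, H = side G E x

/-- `E` is `f`-balanced: each of its halfspaces has at least `n / f n` vertices. -/
def IsBalanced (G : SimpleGraph V) (f : ℕ → ℝ) (E : Set (Sym2 V)) : Prop :=
  ∀ H, IsHalfspace G E H → (Nat.card V : ℝ) / f (Nat.card V) ≤ (H.ncard : ℝ)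

/-- The family of median graphs all of whose Theta-classes are `f`-unbalanced. -/
def InUnbalancedFamily (f : ℕ → ℝ) (G : SimpleGraph V) : Prop :=
  IsMedianGraph G ∧ ∀ E, IsThetaClass G E → ¬ IsBalanced G f E

/-- The minority halfspace of `E`: the halfspace with fewer vertices than its complement. -/
def minorityHalfspace (G : SimpleGraph V) (E : Set (Sym2 V)) : Set V :=
  {x | (side G E x).ncard < (side G E x)ᶜ.ncard}

/-- Median vertices: those minimizing the sum of distances. -/
def IsMedianVertex [Fintype V] (G : SimpleGraph V) (u : V) : Prop :=
  ∀ w, ∑ v, G.dist u v ≤ ∑ v, G.dist w v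

/-- The ladder set of `u, v`: the Theta-classes which separate `u` from `v` and have an edge
incident with `u`. -/
def ladderSet (G : SimpleGraph V) (u v : V) : Set (Set (Sym2 V)) :=
  {E | IsThetaClass G E ∧ v ∉ side G E u ∧ ∃ e ∈ E, u ∈ e}

/-- The weighted distance (not symmetric). -/
noncomputable def wdist (G : SimpleGraph V) (ω : V → ℕ) (u v : V) : ℕ := G.dist u v + ω v

/-- The weighted eccentricity (used on finite graphs only). -/
noncomputable def wecc (G : SimpleGraph V) (ω : V → ℕ) (u : V) : ℕ := ⨆ v, wdist G ω u v

open Classical in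
/-- The weighted eccentricity of `u` in the induced subgraph `G[S]`, distances being those of
`G[S]`; it is `0` if `u ∉ S`. -/
noncomputable def weccOn (G : SimpleGraph V) (S : Set V) (ω : V → ℕ) (u : V) : ℕ :=
  if h : u ∈ S then wecc (G.induce S) (fun y : S => ω y) ⟨u, h⟩ else 0

/-- `u` is an admissible choice of a farthest vertex from `v₀`: it realizes the weighted
eccentricity of `v₀`, and `v₀` itself is chosen whenever it realizes it. -/
def IsUmax (G : SimpleGraph V) (ω : V → ℕ) (v₀ u : V) : Prop :=
  wdist G ω v₀ u = wecc G ω v₀ ∧ (wdist G ω v₀ v₀ = wecc G ω v₀ → u = v₀)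

/-- The vertices of `H` with a neighbour outside `H`. -/
def boundary (G : SimpleGraph V) (H : Set V) : Set V := {x | x ∈ H ∧ ∃ y, y ∉ H ∧ G.Adj x y}

/-- `g` is the `H`-gate of `v`. -/
def IsGate (G : SimpleGraph V) (H : Set V) (v g : V) : Prop :=
  g ∈ H ∧ ∀ x ∈ H, g ∈ interval G v x

/-- The open fiber of `x`: the vertices other than `x` whose `H`-gate is `x`. -/
def openFiber (G : SimpleGraph V) (H : Set V) (x : V) : Set V := {z | IsGate G H z x ∧ z ≠ x}

open Classical in
/-- The weight which replaces `ω x`, for `x` in the boundary of `H`, by the maximum weighted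
distance from `x` to a vertex of its open fiber. -/
noncomputable def fiberWeight (G : SimpleGraph V) (H : Set V) (ω : V → ℕ) (x : V) : ℕ :=
  if x ∈ boundary G H then ⨆ z : openFiber G H x, wdist G ω x z else ω x

/-! ## Slice decomposition

`E 0, E 1, …, E (ℓ-1)` is the chosen enumeration `E_1, …, E_ℓ` of the wide ladder. -/

/-- The vertex sets of the large sets: `G_0 = G` and `G_{i+1}` is `G_i` without the minority
halfspace of the class of index `i + 1`. -/
def largeSet (G : SimpleGraph V) (E : ℕ → Set (Sym2 V)) : ℕ → Set V
  | 0 => Set.univ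
  | i + 1 => largeSet G E i \ minorityHalfspace G (E i)

/-- The vertex set of the slice `S_i`. -/
def slice (G : SimpleGraph V) (E : ℕ → Set (Sym2 V)) (i : ℕ) : Set V :=
  largeSet G E i \ largeSet G E (i + 1)

open Classical in
/-- The weight `ω_i^*` of the slice `S_i`: boundary, gates and fibers of `S_i` are those in the
graph `G_i`. Only its values on `S_i` are ever used. -/
noncomputable def sliceWeight (G : SimpleGraph V) (ω : V → ℕ) (E : ℕ → Set (Sym2 V)) (i : ℕ)
    (x : V) : ℕ :=
  if h : x ∈ largeSet G E i then
    fiberWeight (G.induce (largeSet G E i)) (Subtype.val ⁻¹' slice G E i)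
      (fun y : largeSet G E i => ω y) ⟨x, h⟩
  else ω x

/-- The domain `S_i ∪ S_{i+1} ∪ … ∪ S_{ℓ-1}` of the labeling `B_i`. -/
def labelDomain (G : SimpleGraph V) (E : ℕ → Set (Sym2 V)) (ℓ i : ℕ) : Set V :=
  {u | ∃ j, i ≤ j ∧ j < ℓ ∧ u ∈ slice G E j}

open Classical in
/-- The labeling `B_i`: the weighted eccentricity in `(G_i, ω)` on `labelDomain`, and `0`
elsewhere. In particular `B_ℓ` carries no information. -/
noncomputable def label (G : SimpleGraph V) (ω : V → ℕ) (E : ℕ → Set (Sym2 V)) (ℓ i : ℕ)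
    (u : V) : ℕ :=
  if u ∈ labelDomain G E ℓ i then weccOn G (largeSet G E i) ω u else 0

/-- The index `j < ℓ` of the slice that contains `v`, or `ℓ` if `v` is in no slice, i.e. is a
vertex of `G_ℓ`. -/
noncomputable def sliceIndex (G : SimpleGraph V) (E : ℕ → Set (Sym2 V)) (ℓ : ℕ) (v : V) : ℕ :=
  sInf {j | v ∈ slice G E j ∨ j = ℓ}

/-- The setting: a weighted median graph with at least three vertices and without
`(2 log)`-balanced Theta-class, its median vertex `v₀`, a farthest vertex `umax ≠ v₀`, and an
enumeration `E 0, …, E (ℓ-1)` of the wide ladder. -/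
structure SliceSetting [Fintype V] (G : SimpleGraph V) (ω : V → ℕ) (v₀ umax : V)
    (E : ℕ → Set (Sym2 V)) (ℓ : ℕ) : Prop where
  three_le : 3 ≤ Nat.card V
  unbalanced : InUnbalancedFamily (fun n => 2 * Real.log n) G
  median : IsMedianVertex G v₀
  farthest : IsUmax G ω v₀ umax
  ne : umax ≠ v₀
  enum : Set.BijOn E (Set.Iio ℓ) (ladderSet G v₀ umax)

/-! ## Random access machine

Structured programs on a machine with registers and arrays that hold natural numbers. An array
cell is addressed through a register. Every elementary instruction and every evaluation of a test
costs one step. There is no multiplication, and a machine with word bound `W` gets stuck when it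
would write a number larger than `W`; so `W = O(N)` stands for words of `log N + O(1)` bits. -/

/-- The memory: `reg r` is the content of register `r`, and `mem a p` that of the cell `p` of the
array `a`. -/
structure State where
  reg : ℕ → ℕ
  mem : ℕ → ℕ → ℕ

/-- Elementary instructions. -/
inductive Instr where
  /-- `reg d := c` -/
  | const (d c : ℕ)
  /-- `reg d := reg x + reg y` -/
  | add (d x y : ℕ)
  /-- `reg d := reg x - reg y` (truncated) -/
  | sub (d x y : ℕ)
  /-- `reg d := mem a (reg x)` -/
  | load (d a x : ℕ)
  /-- `mem a (reg x) := reg y` -/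
  | store (a x y : ℕ)

/-- The number written by an instruction. -/
def Instr.value (s : State) : Instr → ℕ
  | const _ c => c
  | add _ x y => s.reg x + s.reg y
  | sub _ x y => s.reg x - s.reg y
  | load _ a x => s.mem a (s.reg x)
  | store _ _ y => s.reg y

/-- The effect of an instruction. -/
def Instr.run (s : State) : Instr → State
  | const d c => ⟨Function.update s.reg d c, s.mem⟩
  | add d x y => ⟨Function.update s.reg d (s.reg x + s.reg y), s.mem⟩
  | sub d x y => ⟨Function.update s.reg d (s.reg x - s.reg y), s.mem⟩
  | load d a x => ⟨Function.update s.reg d (s.mem a (s.reg x)), s.mem⟩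
  | store a x y =>
      ⟨s.reg, Function.update s.mem a (Function.update (s.mem a) (s.reg x) (s.reg y))⟩

/-- Comparisons of two registers. -/
inductive Test where
  | lt (x y : ℕ)
  | eq (x y : ℕ)

/-- Truth of a comparison. -/
def Test.holds (s : State) : Test → Prop
  | lt x y => s.reg x < s.reg y
  | eq x y => s.reg x = s.reg y

/-- Programs. -/
inductive Program where
  | skip
  | instr (c : Instr)
  | seq (p q : Program)
  | ite (b : Test) (p q : Program)
  | loop (b : Test) (p : Program)

/-- `Exec W p s t s'`: on a machine with word bound `W`, the program `p` started in `s` halts after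
exactly `t` steps in `s'`. (`loop b p` is the while loop.) -/
inductive Exec (W : ℕ) : Program → State → ℕ → State → Prop where
  | skip (s : State) : Exec W .skip s 1 s
  | instr (c : Instr) (s : State) (h : c.value s ≤ W) : Exec W (.instr c) s 1 (c.run s)
  | seq {p q : Program} {s s' s'' : State} {t t' : ℕ} (hp : Exec W p s t s')
      (hq : Exec W q s' t' s'') : Exec W (.seq p q) s (t + t') s''
  | ite_true {b : Test} {p q : Program} {s s' : State} {t : ℕ} (hb : b.holds s)
      (hp : Exec W p s t s') : Exec W (.ite b p q) s (1 + t) s'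
  | ite_false {b : Test} {p q : Program} {s s' : State} {t : ℕ} (hb : ¬ b.holds s)
      (hq : Exec W q s t s') : Exec W (.ite b p q) s (1 + t) s'
  | loop_false {b : Test} {p : Program} {s : State} (hb : ¬ b.holds s) :
      Exec W (.loop b p) s 1 s
  | loop_true {b : Test} {p : Program} {s s' s'' : State} {t t' : ℕ} (hb : b.holds s)
      (hp : Exec W p s t s') (hl : Exec W (.loop b p) s' t' s'') :
      Exec W (.loop b p) s (1 + t + t') s''

/-! ## Input encoding -/

/-- An adjacency list representation of a graph: a numbering of the vertices and, for each vertex,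
the list of its neighbours, in any order. -/
structure AdjLists (G : SimpleGraph V) where
  size : ℕ
  num : V ≃ Fin size
  nbrs : V → List V
  nodup : ∀ v, (nbrs v).Nodup
  mem_nbrs : ∀ v w, w ∈ nbrs v ↔ G.Adj v w

/-- The neighbour lists, as lists of vertex numbers, in the order of the numbering. -/
def AdjLists.rows {G : SimpleGraph V} (A : AdjLists G) : List (List ℕ) :=
  (List.finRange A.size).map fun p => (A.nbrs (A.num.symm p)).map fun w => (A.num w : ℕ)

/-- The array of the values of `f`, indexed by vertex numbers. -/
def AdjLists.vertexArray {G : SimpleGraph V} (A : AdjLists G) (f : V → ℕ) (p : ℕ) : ℕ :=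
  if h : p < A.size then f (A.num.symm ⟨p, h⟩) else 0

/-- The initial memory for a graph given by adjacency lists, with the numbers `params` and the
vertex labelings `labels`. Register `0` holds the number of vertices, the next registers hold
`params`. Array `0` is reserved for the output; array `2` is the concatenation of the neighbour
lists, and the list of vertex number `p` occupies its cells from `mem 1 p` to `mem 1 (p+1) - 1`;
the arrays `3, 4, …` hold `labels`. Everything else is `0`. -/
def AdjLists.initial {G : SimpleGraph V} (A : AdjLists G) (params : List ℕ)
    (labels : List (V → ℕ)) : State where
  reg r := (A.size :: params).getD r 0
  mem a := match a with
    | 0 => fun _ => 0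
    | 1 => fun p => (A.rows.take p).flatten.length
    | 2 => fun p => A.rows.flatten.getD p 0
    | a + 3 => A.vertexArray (labels.getD a fun _ => 0)

/-- Input of the recursive step: the graph `G_i`, the numbers `i` and `ℓ`, and on the vertices of
`G_i` the weights, the slice indices, the weighted eccentricities of `(S_i, ω)` and of
`(S_i, ω_i^*)`, and the labels `B_{i+1}`. -/
noncomputable def stepInput (G : SimpleGraph V) (ω : V → ℕ) (E : ℕ → Set (Sym2 V)) (ℓ i : ℕ)
    (A : AdjLists (G.induce (largeSet G E i))) : State :=
  A.initial [i, ℓ]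
    [fun v => ω v,
     fun v => sliceIndex G E ℓ v,
     fun v => weccOn G (slice G E i) ω v,
     fun v => weccOn G (slice G E i) (sliceWeight G ω E i) v,
     fun v => label G ω E ℓ (i + 1) v]

/-- Input of the whole computation: the graph `G`, the number `ℓ`, and on the vertices of `G` the
weights, the slice indices, and, for the vertices `v` of each slice `S_j`, the weighted
eccentricities of `v` in `(S_j, ω)` and in `(S_j, ω_j^*)` (`0` on the vertices of `G_ℓ`). -/
noncomputable def slicesInput (G : SimpleGraph V) (ω : V → ℕ) (E : ℕ → Set (Sym2 V)) (ℓ : ℕ)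
    (A : AdjLists G) : State :=
  A.initial [ℓ]
    [ω,
     sliceIndex G E ℓ,
     fun v => if sliceIndex G E ℓ v < ℓ then
       weccOn G (slice G E (sliceIndex G E ℓ v)) ω v else 0,
     fun v => if sliceIndex G E ℓ v < ℓ then
       weccOn G (slice G E (sliceIndex G E ℓ v)) (sliceWeight G ω E (sliceIndex G E ℓ v)) v
       else 0]

/-- `|V(G)| + |E(G)| + max ω`. -/
noncomputable def inputMagnitude (G : SimpleGraph V) (ω : V → ℕ) : ℕ :=
  Nat.card V + G.edgeSet.ncard + ⨆ v, ω v

end MedianEcc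

namespace MedianEcc

universe u

variable {V : Type u} {G : SimpleGraph V}

/-! ## Median graphs -/

/-! For every ladder class the minority halfspace is the side away from `v₀`: minimality of the
distance sum at `v₀` gives that side at most half of the vertices, and equality would make the class
balanced. Hence every `G_i` and every slice is an intersection of halfspaces. These are convex, so
distances in the induced subgraphs are those of `G`, and nearest points are gates.

Labels of `B_i` come from `B_{i+1}` as follows. From a vertex of `S_i`, a farthest vertex of `G_i`
lies in `S_i` or is reached through its gate, and the second possibility is what `ω_i^*` records
(`setEcc_eq_max_fiberWeight`). From a vertex of a later slice one also needs the largest weighted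
distance to `S_i`. This is the distance to the gate plus the eccentricity of the gate in `(S_i, ω)`,
so it grows by exactly one with each step away from `S_i` (`setEcc_succ`), and one breadth first
search with all of `S_i` as sources computes it. A vertex of `G_ℓ` is separated from `v₀` by no
ladder class, so `v₀` lies between it and `umax`, and `umax`, which is in `S_0`, is farthest from it
(`setEcc_slice_zero`). On `G_ℓ` it thus suffices to record distances to the slices; `target` does
this, and equals the eccentricity once index `0` is reached.

A search costs a constant times vertices plus edges. Since `G_i` is connected with at least one
edge, this is linear in its edges. For the whole graph, the number of slices is at most `log₂ n`,
because medians realize all `2 ^ ℓ` patterns of membership in the minority halfspaces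
(`two_pow_le`), and there are at most `n log₂ n` edges, because the edges across a halfspace form a
matching (`sum_degree_le`). All numbers written are at most twice the input magnitude. -/

/-- The vertices closer to `u` than to `v`. -/
def halfspace (G : SimpleGraph V) (u v : V) : Set V := {x | G.dist x u < G.dist x v}

/-- Geodesically convex sets of vertices. -/
def IsGeodConvex (G : SimpleGraph V) (C : Set V) : Prop :=
  ∀ x ∈ C, ∀ y ∈ C, interval G x y ⊆ C

lemma mem_interval {u v x : V} :
    x ∈ interval G u v ↔ G.dist u x + G.dist x v = G.dist u v := Iff.rfl

lemma exists_adj_dist_succ (hc : G.Connected) {u v : V} (h : u ≠ v) :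
    ∃ w, G.Adj u w ∧ G.dist w v + 1 = G.dist u v := by
  obtain ⟨p, hp⟩ := hc.exists_walk_length_eq_dist u v
  cases p with
  | nil => exact absurd rfl h
  | @cons _ w _ hadj q =>
    refine ⟨w, hadj, ?_⟩
    have h1 : G.dist w v ≤ q.length := SimpleGraph.dist_le q
    have h2 : G.dist u v ≤ G.dist u w + G.dist w v := hc.dist_triangle
    rw [SimpleGraph.dist_eq_one_iff_adj.2 hadj] at h2
    simp only [SimpleGraph.Walk.length_cons] at hp
    omega

lemma dist_le_succ_of_adj (hc : G.Connected) {u v : V} (h : G.Adj u v) (x : V) :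
    G.dist x u ≤ G.dist x v + 1 := by
  have h2 : G.dist x u ≤ G.dist x v + G.dist v u := hc.dist_triangle
  rwa [SimpleGraph.dist_eq_one_iff_adj.2 h.symm] at h2

/-- The definition covers distinct triples only; if two vertices coincide, the repeated one is a
median. -/
lemma IsMedianGraph.exists_median (hG : IsMedianGraph G) (x y z : V) :
    ∃ m, m ∈ interval G x y ∧ m ∈ interval G y z ∧ m ∈ interval G z x := by
  simp only [mem_interval]
  by_cases h1 : x = y
  · exact ⟨x, by subst h1; simp⟩
  by_cases h2 : y = z
  · exact ⟨y, by subst h2; simp⟩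
  by_cases h3 : z = x
  · exact ⟨z, by subst h3; simp⟩
  obtain ⟨m, ⟨⟨hm1, hm2⟩, hm3⟩, -⟩ := hG.2 x y z h1 h2 h3
  exact ⟨m, hm1, hm2, hm3⟩

/-- This is bipartiteness: the median of `u`, `v`, `x` is an endpoint of the edge, and that endpoint
lies between the other one and `x`. -/
lemma IsMedianGraph.dist_adj (hG : IsMedianGraph G) {u v : V} (h : G.Adj u v) (x : V) :
    G.dist x v = G.dist x u + 1 ∨ G.dist x u = G.dist x v + 1 := by
  obtain ⟨m, h1, h2, h3⟩ := hG.exists_median u v x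
  have huv := SimpleGraph.dist_eq_one_iff_adj.2 h
  have hvu := SimpleGraph.dist_eq_one_iff_adj.2 h.symm
  simp only [mem_interval] at h1 h2 h3
  rw [huv] at h1
  rcases Nat.eq_zero_or_pos (G.dist u m) with h0 | h0
  · obtain rfl := (hG.1.dist_eq_zero_iff).1 h0
    left
    rw [SimpleGraph.dist_comm (u := x) (v := v), SimpleGraph.dist_comm (u := x)]
    omega
  · have h0 : G.dist m v = 0 := by omega
    obtain rfl := (hG.1.dist_eq_zero_iff).1 h0
    right
    omega

lemma IsMedianGraph.notMem_halfspace (hG : IsMedianGraph G) {u v : V} (h : G.Adj u v) {x : V} :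
    x ∉ halfspace G u v ↔ x ∈ halfspace G v u := by
  have := hG.dist_adj h x
  simp only [halfspace, Set.mem_ofPred_eq]
  omega

lemma IsMedianGraph.dist_of_mem_halfspace (hG : IsMedianGraph G) {u v x : V} (h : G.Adj u v)
    (hx : x ∈ halfspace G u v) : G.dist x v = G.dist x u + 1 := by
  have := hG.dist_adj h x
  simp only [halfspace, Set.mem_ofPred_eq] at hx
  omega

lemma left_mem_halfspace {u v : V} (h : G.Adj u v) : u ∈ halfspace G u v := by
  simp [halfspace, SimpleGraph.dist_eq_one_iff_adj.2 h]

lemma IsMedianGraph.dist_eq_two (hG : IsMedianGraph G) {u v w : V} (h1 : G.Adj u v)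
    (h2 : G.Adj v w) (h : u ≠ w) : G.dist u w = 2 := by
  have := hG.dist_adj h2 u
  rw [SimpleGraph.dist_eq_one_iff_adj.2 h1] at this
  have h0 := (hG.1.dist_eq_zero_iff (u := u) (v := w)).not.2 h
  omega

/-- There is no `K_{2,3}` in a median graph. -/
lemma IsMedianGraph.no_three_common_neighbors (hG : IsMedianGraph G) {a b x y z : V}
    (hab : a ≠ b) (hxy : x ≠ y) (hyz : y ≠ z) (hzx : z ≠ x)
    (hax : G.Adj a x) (hay : G.Adj a y) (haz : G.Adj a z)
    (hbx : G.Adj b x) (hby : G.Adj b y) (hbz : G.Adj b z) : False := by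
  -- Both `a` and `b` would be medians of `x`, `y`, `z`.
  obtain ⟨m, -, hm⟩ := hG.2 x y z hxy hyz hzx
  have key : ∀ c, G.Adj c x → G.Adj c y → G.Adj c z → c = m := by
    intro c hx hy hz
    have : ∀ p q, p ≠ q → G.Adj c p → G.Adj c q → c ∈ interval G p q := by
      intro p q hpq hp hq
      rw [mem_interval, hG.dist_eq_two hp.symm hq hpq, SimpleGraph.dist_eq_one_iff_adj.2 hp.symm,
        SimpleGraph.dist_eq_one_iff_adj.2 hq]
    exact hm c ⟨⟨this x y hxy hx hy, this y z hyz hy hz⟩, this z x hzx hz hx⟩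
  exact hab ((key a hax hay haz).trans (key b hbx hby hbz).symm)

/-- The quadrangle condition. -/
lemma IsMedianGraph.quadrangle (hG : IsMedianGraph G) {u y z c : V} (huc : G.Adj u c)
    (hyc : G.Adj y c) (huy : u ≠ y) (h1 : G.dist z c = G.dist z u + 1)
    (h2 : G.dist z y = G.dist z u) :
    ∃ m, G.Adj m u ∧ G.Adj m y ∧ G.dist z m + 1 = G.dist z u ∧ m ≠ c := by
  obtain ⟨m, hm1, hm2, hm3⟩ := hG.exists_median u y z
  simp only [mem_interval] at hm1 hm2 hm3
  rw [hG.dist_eq_two huc hyc.symm huy] at hm1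
  rw [SimpleGraph.dist_comm (u := y) (v := z), SimpleGraph.dist_comm (u := m) (v := z),
    SimpleGraph.dist_comm (u := y) (v := m)] at hm2
  rw [SimpleGraph.dist_comm (u := u) (v := m)] at hm1
  have e1 : G.dist m u = 1 := by omega
  have e2 : G.dist m y = 1 := by omega
  refine ⟨m, SimpleGraph.dist_eq_one_iff_adj.1 e1, SimpleGraph.dist_eq_one_iff_adj.1 e2,
    by omega, ?_⟩
  rintro rfl
  omega

/-- If `z` were on the wrong side of `x y`, then `u` and `y` would be equally far from `z`, and `v`,
`x` one step farther. The quadrangle condition gives a third common neighbour of `u` and `y`, nearer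
to `z`, hence a `K_{2,3}`. -/
lemma IsMedianGraph.halfspace_square_subset (hG : IsMedianGraph G) {u v x y : V}
    (huv : G.Adj u v) (hvy : G.Adj v y) (hyx : G.Adj y x) (hxu : G.Adj x u) (huy : u ≠ y)
    (hvx : v ≠ x) : halfspace G u v ⊆ halfspace G x y := by
  intro z hz
  by_contra hz'
  have h1 := hG.dist_of_mem_halfspace huv hz
  have h2 := hG.dist_of_mem_halfspace hyx ((hG.notMem_halfspace hyx.symm).1 hz')
  have h3 := hG.dist_adj hvy z
  have h4 := hG.dist_adj hxu z
  obtain ⟨m, hmu, hmy, hm, hmv⟩ := hG.quadrangle huv hvy.symm huy h1 (by omega)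
  refine hG.no_three_common_neighbors huy hvx (x := v) (y := x) (z := m) ?_ hmv
    huv hxu.symm hmu.symm hvy.symm hyx hmy.symm
  rintro rfl
  omega

/-! ### Theta-classes as cuts between complementary convex halfspaces -/

/-- A step from `x` to `x'` towards `u` stays on the same side. The quadrangle condition seen from
`v` completes `x'`, `x`, `y` to a square whose opposite edge also crosses and is nearer to `u`. -/
lemma IsMedianGraph.reflTransGen_of_crossing (hG : IsMedianGraph G) {u v : V} (huv : G.Adj u v)
    (k : ℕ) : ∀ x y, G.Adj x y → x ∈ halfspace G u v → y ∈ halfspace G v u → G.dist x u = k →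
      Relation.ReflTransGen (SquareOpposite G) s(u, v) s(x, y) := by
  induction k with
  | zero =>
    intro x y hxy hx hy hk
    obtain rfl := (hG.1.dist_eq_zero_iff).1 hk
    have : G.dist y v = 0 := by
      have h1 : G.dist y v < G.dist y x := hy
      rw [SimpleGraph.dist_eq_one_iff_adj.2 hxy.symm] at h1
      omega
    obtain rfl := (hG.1.dist_eq_zero_iff).1 this
    exact Relation.ReflTransGen.refl
  | succ k ih =>
    intro x y hxy hx hy hk
    obtain ⟨x', hxx', hx'⟩ := exists_adj_dist_succ hG.1 (u := x) (v := u) (by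
      rintro rfl; simp at hk)
    have a1 := hG.dist_of_mem_halfspace huv hx
    have a2 := hG.dist_of_mem_halfspace huv.symm hy
    have b1 := hG.dist_adj hxy u
    have b2 := hG.dist_adj hxy v
    have b3 := hG.dist_adj hxx' v
    have b4 := hG.dist_adj huv x'
    simp only [SimpleGraph.dist_comm (u := u), SimpleGraph.dist_comm (u := v)] at b1 b2 b3
    have hx'W : x' ∈ halfspace G u v := by
      simp only [halfspace, Set.mem_ofPred_eq]; omega
    obtain ⟨m, hm1, hm2, hm3, hm4⟩ := hG.quadrangle (u := y) (y := x') (z := v) (c := x)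
      hxy.symm hxx'.symm (by rintro rfl; omega)
      (by simp only [SimpleGraph.dist_comm (u := v)]; omega)
      (by simp only [SimpleGraph.dist_comm (u := v)]; omega)
    simp only [SimpleGraph.dist_comm (u := v)] at hm3
    have b5 := hG.dist_adj hm1 u
    have b6 := hG.dist_adj hm2 u
    have b7 := hG.dist_adj huv m
    simp only [SimpleGraph.dist_comm (u := u)] at b5 b6
    have hmW : m ∈ halfspace G v u := by
      simp only [halfspace, Set.mem_ofPred_eq]; omega
    refine (ih x' m hm2.symm hx'W hmW (by omega)).tail
      ⟨x', m, x, y, rfl, rfl, hm2.symm, hm1, hxy.symm, hxx', ?_, hm4⟩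
    rintro rfl
    omega

/-- The Theta-class of the edge `e`. -/
def thetaClass (G : SimpleGraph V) (e : Sym2 V) : Set (Sym2 V) :=
  {f | Relation.ReflTransGen (SquareOpposite G) e f}

/-- Each square preserves the halfspace, so induction along the chain applies. The orientation has
to be chosen anew at each step, since edges are unordered pairs. -/
lemma IsMedianGraph.exists_halfspace_eq (hG : IsMedianGraph G) {u v : V} (huv : G.Adj u v)
    {f : Sym2 V} (hf : f ∈ thetaClass G s(u, v)) :
    ∃ x y, f = s(x, y) ∧ G.Adj x y ∧ halfspace G u v = halfspace G x y := by
  change Relation.ReflTransGen (SquareOpposite G) s(u, v) f at hf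
  induction hf with
  | refl => exact ⟨u, v, rfl, huv, rfl⟩
  | tail _ hsq ih =>
    obtain ⟨a, b, hab, hadj, hW⟩ := ih
    obtain ⟨p, q, x, y, he, hf, hpq, hqy, hyx, hxp, hpy, hqx⟩ := hsq
    rw [he, Sym2.eq_iff] at hab
    rcases hab with ⟨rfl, rfl⟩ | ⟨rfl, rfl⟩
    · exact ⟨x, y, hf, hyx.symm, hW.trans <|
        (hG.halfspace_square_subset hpq hqy hyx hxp hpy hqx).antisymm
          (hG.halfspace_square_subset hyx.symm hqy.symm hpq.symm hxp.symm hqx.symm hpy.symm)⟩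
    · exact ⟨y, x, hf.trans Sym2.eq_swap, hyx, hW.trans <|
        (hG.halfspace_square_subset hpq.symm hxp.symm hyx.symm hqy.symm hqx hpy).antisymm
          (hG.halfspace_square_subset hyx hxp hpq hqy hpy.symm hqx.symm)⟩

lemma IsMedianGraph.mem_thetaClass (hG : IsMedianGraph G) {u v x y : V} (huv : G.Adj u v) :
    s(x, y) ∈ thetaClass G s(u, v) ↔
      G.Adj x y ∧ (x ∈ halfspace G u v ↔ y ∉ halfspace G u v) := by
  constructor
  · intro h
    obtain ⟨a, b, hab, hadj, hW⟩ := hG.exists_halfspace_eq huv h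
    rw [hW]
    have ha := left_mem_halfspace hadj
    have hb := (hG.notMem_halfspace hadj).2 (left_mem_halfspace hadj.symm)
    rcases Sym2.eq_iff.1 hab with ⟨rfl, rfl⟩ | ⟨rfl, rfl⟩
    · exact ⟨hadj, by simp [ha, hb]⟩
    · exact ⟨hadj.symm, by simp [ha, hb]⟩
  · rintro ⟨hxy, h⟩
    by_cases hx : x ∈ halfspace G u v
    · exact hG.reflTransGen_of_crossing huv _ x y hxy hx
        ((hG.notMem_halfspace huv).1 (h.1 hx)) rfl
    · have hy : y ∈ halfspace G u v := by tauto
      rw [show s(x, y) = s(y, x) from Sym2.eq_swap]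
      exact hG.reflTransGen_of_crossing huv _ y x hxy.symm hy ((hG.notMem_halfspace huv).1 hx) rfl

lemma IsMedianGraph.halfspace_eq_of_crossing (hG : IsMedianGraph G) {u v x y : V}
    (huv : G.Adj u v) (hxy : G.Adj x y) (hx : x ∈ halfspace G u v) (hy : y ∉ halfspace G u v) :
    halfspace G u v = halfspace G x y := by
  obtain ⟨a, b, hab, hadj, hW⟩ := hG.exists_halfspace_eq huv
    ((hG.mem_thetaClass huv).2 ⟨hxy, by simp [hx, hy]⟩)
  rcases Sym2.eq_iff.1 hab with ⟨rfl, rfl⟩ | ⟨rfl, rfl⟩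
  · exact hW
  · rw [hW] at hy
    exact absurd (left_mem_halfspace hadj) hy

/-- The edge `x y` defines the same halfspace, so `z` is nearer to `y` than to its neighbour `x`.
The edges across a halfspace therefore form a matching. -/
lemma IsMedianGraph.crossing_unique (hG : IsMedianGraph G) {u v x y z : V} (huv : G.Adj u v)
    (hxy : G.Adj x y) (hxz : G.Adj x z) (hx : x ∈ halfspace G u v) (hy : y ∉ halfspace G u v)
    (hz : z ∉ halfspace G u v) : y = z := by
  rw [hG.halfspace_eq_of_crossing huv hxy hx hy, hG.notMem_halfspace hxy] at hz
  simp only [halfspace, Set.mem_ofPred_eq, SimpleGraph.dist_eq_one_iff_adj.2 hxz.symm] at hz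
  exact ((hG.1.dist_eq_zero_iff).1 (by omega)).symm

/-- Along a geodesic from `x` to `y`, an edge `z' z` leaving the halfspace would define that same
halfspace; then `y` would be nearer to `z'` than to `z`, which is impossible. -/
lemma IsMedianGraph.halfspace_convex (hG : IsMedianGraph G) {u v : V} (huv : G.Adj u v) :
    IsGeodConvex G (halfspace G u v) := by
  intro x hx y hy
  have key : ∀ k z, G.dist z x = k → z ∈ interval G x y → z ∈ halfspace G u v := by
    intro k
    induction k with
    | zero =>
      intro z hk _
      obtain rfl := (hG.1.dist_eq_zero_iff).1 hk
      exact hx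
    | succ k ih =>
      intro z hk hz
      rw [mem_interval] at hz
      obtain ⟨z', hzz', hz'⟩ := exists_adj_dist_succ hG.1 (u := z) (v := x) (by
        rintro rfl; simp at hk)
      have h1 : G.dist x y ≤ G.dist x z' + G.dist z' y := hG.1.dist_triangle
      have h2 := hG.dist_adj hzz' y
      rw [SimpleGraph.dist_comm (u := x) (v := z)] at hz
      rw [SimpleGraph.dist_comm (u := x) (v := z')] at h1
      simp only [SimpleGraph.dist_comm (u := y)] at h2
      have h3 := ih z' (by omega) (by
        rw [mem_interval, SimpleGraph.dist_comm (u := x) (v := z')]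
        omega)
      by_contra hzW
      rw [hG.halfspace_eq_of_crossing huv hzz'.symm h3 hzW] at hy
      simp only [halfspace, Set.mem_ofPred_eq] at hy
      simp only [SimpleGraph.dist_comm (u := y)] at hy
      omega
  exact fun z hz => key _ z rfl hz

lemma IsMedianGraph.halfspace_compl (hG : IsMedianGraph G) {u v : V} (huv : G.Adj u v) :
    (halfspace G u v)ᶜ = halfspace G v u := by
  ext x
  exact hG.notMem_halfspace huv

/-- Steps towards `u` stay in the halfspace, so it remains connected when the class is deleted. The
class contains every crossing edge, so nothing leads out. -/
lemma IsMedianGraph.side_thetaClass (hG : IsMedianGraph G) {u v x : V} (huv : G.Adj u v)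
    (hx : x ∈ halfspace G u v) : side G (thetaClass G s(u, v)) x = halfspace G u v := by
  have hreach : ∀ k y, G.dist y u = k → y ∈ halfspace G u v →
      (G.deleteEdges (thetaClass G s(u, v))).Reachable y u := by
    intro k
    induction k with
    | zero =>
      intro y hk _
      obtain rfl := (hG.1.dist_eq_zero_iff).1 hk
      exact SimpleGraph.Reachable.refl _
    | succ k ih =>
      intro y hk hy
      obtain ⟨y', hyy', hy'⟩ := exists_adj_dist_succ hG.1 (u := y) (v := u) (by
        rintro rfl; simp at hk)
      have hW : y' ∈ halfspace G u v := by
        have h1 := hG.dist_of_mem_halfspace huv hy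
        have h2 := hG.dist_adj hyy' v
        simp only [SimpleGraph.dist_comm (u := v)] at h2
        simp only [halfspace, Set.mem_ofPred_eq]
        omega
      refine (SimpleGraph.Adj.reachable ?_).trans (ih y' (by omega) hW)
      rw [SimpleGraph.deleteEdges_adj, hG.mem_thetaClass huv]
      exact ⟨hyy', by tauto⟩
  ext y
  constructor
  · rintro ⟨p⟩
    induction p with
    | nil => exact hx
    | cons h p ih =>
      rw [SimpleGraph.deleteEdges_adj, hG.mem_thetaClass huv] at h
      exact ih (by tauto)
  · intro hy
    exact (hreach _ x rfl hx).trans (hreach _ y rfl hy).symm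

lemma isThetaClass_iff {E : Set (Sym2 V)} :
    IsThetaClass G E ↔ ∃ u v, G.Adj u v ∧ E = thetaClass G s(u, v) := by
  constructor
  · rintro ⟨e, he, rfl⟩
    induction e with
    | h u v => exact ⟨u, v, he, rfl⟩
  · rintro ⟨u, v, h, rfl⟩
    exact ⟨s(u, v), h, rfl⟩

/-- A class is a cut, and each of its edges defines the same pair of halfspaces, so any member
generates it. -/
lemma IsMedianGraph.thetaClass_eq_of_mem (hG : IsMedianGraph G) {E : Set (Sym2 V)}
    (hE : IsThetaClass G E) {u v : V} (he : s(u, v) ∈ E) :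
    G.Adj u v ∧ E = thetaClass G s(u, v) := by
  obtain ⟨a, b, hab, rfl⟩ := isThetaClass_iff.1 hE
  have hmem := (hG.mem_thetaClass hab).1 he
  have huv := hmem.1
  refine ⟨huv, ?_⟩
  ext f
  induction f with
  | h x y =>
    rw [hG.mem_thetaClass hab, hG.mem_thetaClass huv]
    by_cases hu : u ∈ halfspace G a b
    · rw [hG.halfspace_eq_of_crossing hab huv hu (hmem.2.1 hu)]
    · have hv : v ∈ halfspace G a b := by tauto
      rw [hG.halfspace_eq_of_crossing hab huv.symm hv hu, ← hG.halfspace_compl huv]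
      simp only [Set.mem_compl_iff]
      tauto

/-! ## Convex sets -/

lemma IsGeodConvex.inter {C D : Set V} (hC : IsGeodConvex G C) (hD : IsGeodConvex G D) :
    IsGeodConvex G (C ∩ D) :=
  fun x hx y hy _ hz => ⟨hC x hx.1 y hy.1 hz, hD x hx.2 y hy.2 hz⟩

/-- Nearest points of convex sets of a median graph are gates. -/
lemma IsMedianGraph.dist_via_nearest (hG : IsMedianGraph G) {C : Set V} (hC : IsGeodConvex G C)
    {z g : V} (hg : g ∈ C) (hmin : ∀ c ∈ C, G.dist z g ≤ G.dist z c) {x : V} (hx : x ∈ C) :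
    G.dist z g + G.dist g x = G.dist z x := by
  -- The median is in `C` by convexity and between `z` and `g`, so by minimality it is `g`.
  obtain ⟨m, h1, h2, h3⟩ := hG.exists_median z g x
  have := hmin m (hC g hg x hx h2)
  simp only [mem_interval] at h1 h2 h3
  have h0 : G.dist m g = 0 := by omega
  obtain rfl := (hG.1.dist_eq_zero_iff).1 h0
  rw [SimpleGraph.dist_comm (u := x) (v := m), SimpleGraph.dist_comm (u := m) (v := z),
    SimpleGraph.dist_comm (u := x) (v := z)] at h3
  omega

lemma exists_nearest {C : Set V} (hC : C.Nonempty) (z : V) :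
    ∃ g ∈ C, ∀ c ∈ C, G.dist z g ≤ G.dist z c := by
  obtain ⟨g, hg, hmin⟩ := exists_minimalFor_of_wellFoundedLT (· ∈ C) (G.dist z) hC
  exact ⟨g, hg, fun c hc => (le_total _ _).elim id (fun h => hmin hc h)⟩

lemma IsGeodConvex.induce_connected_dist (hc : G.Connected) {C : Set V} (hC : IsGeodConvex G C)
    (a b : C) : (G.induce C).Reachable a b ∧ (G.induce C).dist a b = G.dist a b := by
  have key : ∀ k (a : C), G.dist a b = k → ∃ p : (G.induce C).Walk a b, p.length = k := by
    intro k
    induction k with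
    | zero =>
      intro a hk
      obtain rfl := Subtype.ext ((hc.dist_eq_zero_iff).1 hk)
      exact ⟨.nil, rfl⟩
    | succ k ih =>
      intro a hk
      obtain ⟨w, haw, hw⟩ := exists_adj_dist_succ hc (u := (a : V)) (v := b) (by
        intro h; rw [h] at hk; simp at hk)
      have hwC : w ∈ C := hC a a.2 b b.2 (by
        rw [mem_interval, SimpleGraph.dist_eq_one_iff_adj.2 haw]; omega)
      obtain ⟨p, hp⟩ := ih ⟨w, hwC⟩ (by simp only; omega)
      exact ⟨.cons (show (G.induce C).Adj a ⟨w, hwC⟩ from haw) p, by simp [hp]⟩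
  obtain ⟨p, hp⟩ := key _ a rfl
  refine ⟨⟨p⟩, le_antisymm (hp ▸ SimpleGraph.dist_le p) ?_⟩
  obtain ⟨q, hq⟩ := SimpleGraph.Reachable.exists_walk_length_eq_dist (G := G.induce C) ⟨p⟩
  rw [← hq]
  have := SimpleGraph.dist_le (q.map (SimpleGraph.Embedding.induce C).toHom)
  rwa [SimpleGraph.Walk.length_map] at this

lemma IsGeodConvex.induce_dist (hc : G.Connected) {C : Set V} (hC : IsGeodConvex G C)
    (a b : C) : (G.induce C).dist a b = G.dist a b :=
  (hC.induce_connected_dist hc a b).2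

/-! ## Farthest points of a set -/

/-- The largest weighted distance from `u` to a vertex of `C`. -/
noncomputable def setEcc (G : SimpleGraph V) (C : Set V) (ω : V → ℕ) (u : V) : ℕ :=
  ⨆ z : C, wdist G ω u z

lemma le_setEcc [Finite V] {C : Set V} (ω : V → ℕ) (u : V) {z : V} (hz : z ∈ C) :
    wdist G ω u z ≤ setEcc G C ω u :=
  le_ciSup (f := fun z : C => wdist G ω u z) (Set.finite_range _).bddAbove ⟨z, hz⟩

lemma setEcc_le {C : Set V} {ω : V → ℕ} {u : V} {b : ℕ} (h : ∀ z ∈ C, wdist G ω u z ≤ b) :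
    setEcc G C ω u ≤ b :=
  ciSup_le' fun z => h z z.2

lemma exists_setEcc [Finite V] {C : Set V} (hC : C.Nonempty) (ω : V → ℕ) (u : V) :
    ∃ z ∈ C, wdist G ω u z = setEcc G C ω u := by
  have := hC.to_subtype
  obtain ⟨z, hz⟩ := exists_eq_ciSup_of_finite (f := fun z : C => wdist G ω u z)
  exact ⟨z, z.2, hz⟩

lemma setEcc_mono [Finite V] {C D : Set V} (h : C ⊆ D) (ω : V → ℕ) (u : V) :
    setEcc G C ω u ≤ setEcc G D ω u :=
  setEcc_le fun _ hz => le_setEcc ω u (h hz)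

lemma setEcc_union [Finite V] (C D : Set V) (ω : V → ℕ) (u : V) :
    setEcc G (C ∪ D) ω u = max (setEcc G C ω u) (setEcc G D ω u) := by
  refine le_antisymm (setEcc_le ?_)
    (max_le (setEcc_mono Set.subset_union_left ω u) (setEcc_mono Set.subset_union_right ω u))
  rintro z (hz | hz)
  · exact le_max_of_le_left (le_setEcc ω u hz)
  · exact le_max_of_le_right (le_setEcc ω u hz)

lemma setEcc_univ (ω : V → ℕ) (u : V) : setEcc G Set.univ ω u = wecc G ω u :=
  (Equiv.Set.univ V).iSup_congr fun _ => rfl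

lemma weccOn_eq_setEcc (hc : G.Connected) {C : Set V} (hC : IsGeodConvex G C) (ω : V → ℕ) {u : V}
    (hu : u ∈ C) : weccOn G C ω u = setEcc G C ω u := by
  rw [weccOn, dif_pos hu, wecc, setEcc]
  simp only [wdist, hC.induce_dist hc]

lemma dist_le_card [Finite V] (hc : G.Connected) (u v : V) : G.dist u v ≤ Nat.card V := by
  have := Fintype.ofFinite V
  obtain ⟨p, hp, hl⟩ := hc.exists_path_of_dist u v
  rw [← hl, Nat.card_eq_fintype_card]
  exact hp.length_lt.le

lemma setEcc_le_card_add [Finite V] (hc : G.Connected) (C : Set V) (ω : V → ℕ) (u : V) :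
    setEcc G C ω u ≤ Nat.card V + ⨆ v, ω v :=
  setEcc_le fun z _ => Nat.add_le_add (dist_le_card hc u z)
    (le_ciSup (Set.finite_range ω).bddAbove z)

/-- The distance from `u` to the set `C`. -/
noncomputable def setDist (G : SimpleGraph V) (C : Set V) (u : V) : ℕ := sInf (G.dist u '' C)

lemma setDist_le {C : Set V} {u z : V} (hz : z ∈ C) : setDist G C u ≤ G.dist u z :=
  Nat.sInf_le ⟨z, hz, rfl⟩

lemma exists_setDist {C : Set V} (hC : C.Nonempty) (u : V) :
    ∃ g ∈ C, G.dist u g = setDist G C u :=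
  Nat.sInf_mem (hC.image _)

lemma setDist_eq_zero (hc : G.Connected) {C : Set V} (hC : C.Nonempty) {u : V} :
    setDist G C u = 0 ↔ u ∈ C := by
  constructor
  · intro h
    obtain ⟨g, hg, hd⟩ := exists_setDist (G := G) hC u
    rw [h] at hd
    exact (hc.dist_eq_zero_iff.1 hd) ▸ hg
  · intro h
    have := setDist_le (G := G) (u := u) h
    simpa using this

lemma setDist_le_succ_of_adj (hc : G.Connected) {C : Set V} (hC : C.Nonempty) {u v : V}
    (h : G.Adj u v) : setDist G C v ≤ setDist G C u + 1 := by
  obtain ⟨g, hg, hd⟩ := exists_setDist (G := G) hC u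
  have h1 := setDist_le (G := G) (u := v) hg
  have h2 := dist_le_succ_of_adj hc h.symm g
  rw [G.dist_comm (u := g), G.dist_comm (u := g)] at h2
  omega

lemma exists_adj_setDist (hc : G.Connected) {C D : Set V} (hCD : C ⊆ D) (hD : IsGeodConvex G D)
    (hC : C.Nonempty) {u : V} (hu : u ∈ D) {k : ℕ} (hk : setDist G C u = k + 1) :
    ∃ v ∈ D, G.Adj u v ∧ setDist G C v = k := by
  obtain ⟨g, hg, hd⟩ := exists_setDist (G := G) hC u
  obtain ⟨v, huv, hv⟩ := exists_adj_dist_succ hc (u := u) (v := g) (by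
    rintro rfl; simp at hd; omega)
  have h1 := setDist_le (G := G) (u := v) hg
  have h2 := setDist_le_succ_of_adj hc hC huv.symm
  refine ⟨v, hD u hu g (hCD hg) ?_, huv, by omega⟩
  rw [mem_interval, SimpleGraph.dist_eq_one_iff_adj.2 huv]
  omega

/-- The gate `g` of `x` is at distance at most one more from `w`, so it is nearest to `w` as well.
Through the common gate, all weighted distances to `C` grow by exactly one. -/
lemma IsMedianGraph.setEcc_succ [Finite V] (hG : IsMedianGraph G) {C : Set V}
    (hC : IsGeodConvex G C) (hne : C.Nonempty) (ω : V → ℕ) {x w : V} (hxw : G.Adj x w)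
    (h : setDist G C w = setDist G C x + 1) : setEcc G C ω w = setEcc G C ω x + 1 := by
  obtain ⟨g, hg, hd⟩ := exists_setDist (G := G) hne x
  have hx : ∀ z ∈ C, G.dist x g + G.dist g z = G.dist x z := fun z hz =>
    hG.dist_via_nearest hC hg (fun c hc => hd ▸ setDist_le hc) hz
  have hwg : G.dist w g = G.dist x g + 1 := by
    have h1 := setDist_le (G := G) (u := w) hg
    have h2 := dist_le_succ_of_adj hG.1 hxw.symm g
    rw [G.dist_comm (u := g), G.dist_comm (u := g)] at h2
    omega
  have hw : ∀ z ∈ C, G.dist w g + G.dist g z = G.dist w z := fun z hz =>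
    hG.dist_via_nearest hC hg (fun c hc => by
      have := setDist_le (G := G) (u := w) hc
      omega) hz
  have key : ∀ z ∈ C, wdist G ω w z = wdist G ω x z + 1 := by
    intro z hz
    have h1 := hx z hz
    have h2 := hw z hz
    simp only [wdist]
    omega
  apply le_antisymm
  · exact setEcc_le fun z hz => key z hz ▸ Nat.succ_le_succ (le_setEcc ω x hz)
  · obtain ⟨z, hz, he⟩ := exists_setEcc (G := G) hne ω x
    rw [← he, ← key z hz]
    exact le_setEcc ω w hz

-- A farthest vertex is either in `C`, or is seen from `u` through its gate and so counted in the
-- weight of the gate. Conversely, each value of `ω'` stands for an actual vertex of `D`, so neither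
-- term is too large.
open Classical in
lemma IsMedianGraph.setEcc_eq_max_fiberWeight [Finite V] (hG : IsMedianGraph G) {C D : Set V}
    (hCD : C ⊆ D) (hC : IsGeodConvex G C) (hD : IsGeodConvex G D) (ω ω' : V → ℕ)
    (hω : ∀ x (h : x ∈ D), ω' x =
      fiberWeight (G.induce D) (Subtype.val ⁻¹' C) (fun y : D => ω y) ⟨x, h⟩) {u : V}
    (hu : u ∈ C) : setEcc G D ω u = max (setEcc G C ω u) (setEcc G C ω' u) := by
  have hdist := hD.induce_dist hG.1
  apply le_antisymm
  · apply setEcc_le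
    intro z hz
    by_cases hzC : z ∈ C
    · exact le_max_of_le_left (le_setEcc ω u hzC)
    obtain ⟨g, hg, hmin⟩ := exists_nearest (G := G) ⟨u, hu⟩ z
    have hgate := fun x hx => hG.dist_via_nearest hC hg hmin (x := x) hx
    have hgz : g ≠ z := by
      rintro rfl
      exact hzC hg
    refine le_max_of_le_right (le_trans ?_ (le_setEcc ω' u hg))
    -- The first step from the gate towards `z` stays in `D` and leaves `C`, so the gate is a
    -- boundary vertex and its weight is the fiber maximum.
    obtain ⟨y, hgy, hy⟩ := exists_adj_dist_succ hG.1 hgz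
    have hyD : y ∈ D := hD g (hCD hg) z hz (by
      rw [mem_interval, SimpleGraph.dist_eq_one_iff_adj.2 hgy]; omega)
    have hyC : y ∉ C := fun h => by
      have h1 := hmin y h
      rw [G.dist_comm (u := z), G.dist_comm (u := z)] at h1
      omega
    have hbd : (⟨g, hCD hg⟩ : D) ∈ boundary (G.induce D) (Subtype.val ⁻¹' C) :=
      ⟨hg, ⟨y, hyD⟩, hyC, hgy⟩
    have hfib : (⟨z, hz⟩ : D) ∈ openFiber (G.induce D) (Subtype.val ⁻¹' C) ⟨g, hCD hg⟩ := by
      refine ⟨⟨hg, fun x hx => ?_⟩, fun h => hgz (congrArg Subtype.val h).symm⟩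
      rw [mem_interval, hdist, hdist, hdist]
      exact hgate x hx
    have hle : G.dist g z + ω z ≤ ω' g := by
      rw [hω g (hCD hg), fiberWeight, if_pos hbd]
      refine le_trans (le_of_eq ?_) (le_ciSup (f := fun z : openFiber (G.induce D)
        (Subtype.val ⁻¹' C) ⟨g, hCD hg⟩ => wdist (G.induce D) (fun y : D => ω y)
          ⟨g, hCD hg⟩ z) (Set.finite_range _).bddAbove ⟨⟨z, hz⟩, hfib⟩)
      simp only [wdist, hdist]
    have h1 := hgate u hu
    simp only [wdist]
    rw [G.dist_comm (u := z), G.dist_comm (u := g) (v := u), G.dist_comm (u := z)] at h1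
    omega
  · refine max_le (setEcc_mono hCD ω u) (setEcc_le fun x hx => ?_)
    have hxx := le_setEcc (G := G) ω u (hCD hx)
    rw [wdist, hω x (hCD hx), fiberWeight]
    split_ifs with hbd
    -- For an empty fiber the supremum has the default value `0`, and the distance to `x` itself
    -- suffices.
    · rcases isEmpty_or_nonempty
        (openFiber (G.induce D) (Subtype.val ⁻¹' C) ⟨x, hCD hx⟩) with he | he
      · simp only [ciSup_of_empty, wdist] at hxx ⊢
        simp only [bot_eq_zero']
        omega
      · obtain ⟨⟨⟨z, hz⟩, hgate, hne⟩, he⟩ := exists_eq_ciSup_of_finite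
          (f := fun z : openFiber (G.induce D) (Subtype.val ⁻¹' C) ⟨x, hCD hx⟩ =>
            wdist (G.induce D) (fun y : D => ω y) ⟨x, hCD hx⟩ z)
        rw [← he]
        have h1 := hgate.2 ⟨u, hCD hu⟩ hu
        rw [mem_interval, hdist, hdist, hdist] at h1
        have h2 := le_setEcc (G := G) ω u hz
        simp only [wdist, hdist] at h1 h2 ⊢
        rw [G.dist_comm (u := z), G.dist_comm (u := x) (v := u), G.dist_comm (u := z)] at h1
        omega
    · exact hxx

/-! ## Slices -/

variable {E : ℕ → Set (Sym2 V)} {ℓ : ℕ}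

lemma largeSet_antitone : Antitone (largeSet G E) :=
  antitone_nat_of_succ_le fun _ => Set.sdiff_subset

lemma sliceIndex_le (v : V) : sliceIndex G E ℓ v ≤ ℓ := Nat.sInf_le (Or.inr rfl)

/-- The large sets decrease and the slices are their successive differences, so one number per
vertex encodes membership in all of them. This is how the program sees the decomposition. -/
lemma mem_largeSet_iff {i : ℕ} (hi : i ≤ ℓ) (v : V) :
    v ∈ largeSet G E i ↔ i ≤ sliceIndex G E ℓ v := by
  have hmem : v ∈ slice G E (sliceIndex G E ℓ v) ∨ sliceIndex G E ℓ v = ℓ :=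
    Nat.sInf_mem (s := {j | v ∈ slice G E j ∨ j = ℓ}) ⟨ℓ, Or.inr rfl⟩
  have hlt : ∀ j < sliceIndex G E ℓ v, v ∉ slice G E j := fun j hj h =>
    Nat.notMem_of_lt_sInf (s := {j | v ∈ slice G E j ∨ j = ℓ}) hj (Or.inl h)
  constructor
  · intro h
    by_contra hlt
    rcases hmem with hm | hm
    · exact hm.2 (largeSet_antitone (Nat.succ_le_of_lt (not_le.1 hlt)) h)
    · omega
  · intro h
    induction i with
    | zero => trivial
    | succ k ih =>
      by_contra hk
      exact hlt k (by omega) ⟨ih (by omega) (by omega), hk⟩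

lemma mem_slice_iff {i : ℕ} (hi : i < ℓ) (v : V) :
    v ∈ slice G E i ↔ sliceIndex G E ℓ v = i := by
  rw [slice, Set.mem_sdiff, mem_largeSet_iff hi.le, mem_largeSet_iff (Nat.succ_le_of_lt hi)]
  omega

lemma slice_eq_inter (i : ℕ) : slice G E i = largeSet G E i ∩ minorityHalfspace G (E i) := by
  rw [slice, largeSet, Set.sdiff_sdiff_right_self]

lemma mem_labelDomain_iff (i : ℕ) (v : V) :
    v ∈ labelDomain G E ℓ i ↔ i ≤ sliceIndex G E ℓ v ∧ sliceIndex G E ℓ v < ℓ := by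
  constructor
  · rintro ⟨j, hij, hj, hv⟩
    rw [mem_slice_iff hj] at hv
    omega
  · rintro ⟨h1, h2⟩
    exact ⟨_, h1, h2, (mem_slice_iff h2 v).2 rfl⟩

/-! ### Halfspaces, large sets and slices around the median vertex -/

namespace SliceSetting

variable [Fintype V] {ω : V → ℕ} {v₀ umax : V}

lemma isMedianGraph (h : SliceSetting G ω v₀ umax E ℓ) : IsMedianGraph G := h.unbalanced.1

/-- Moving from `v₀` to `w` shortens by one the distances to vertices nearer to `w` and lengthens
all others by one, so minimality gives `≤`. In case of equality both halfspaces have `n / 2`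
vertices, which is at least `n / (2 log n)` because `n ≥ 3 > e`; the class would be balanced. -/
lemma ncard_halfspace_lt (h : SliceSetting G ω v₀ umax E ℓ) {w : V} (hw : G.Adj v₀ w) :
    (halfspace G w v₀).ncard < (halfspace G v₀ w).ncard := by
  classical
  have hG := h.isMedianGraph
  have hle : (halfspace G w v₀).ncard ≤ (halfspace G v₀ w).ncard := by
    have hsum := h.median w
    have e1 : ∀ v, G.dist w v + (if v ∈ halfspace G w v₀ then 1 else 0) =
        G.dist v₀ v + (if v ∈ halfspace G v₀ w then 1 else 0) := by
      intro v
      have h1 := hG.dist_adj hw v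
      rw [G.dist_comm (u := w), G.dist_comm (u := v₀)]
      rcases h1 with h1 | h1
      · have m1 : v ∈ halfspace G v₀ w := Nat.lt_of_succ_le h1.ge
        rw [if_pos m1, if_neg ((hG.notMem_halfspace hw.symm).2 m1)]
        omega
      · have m1 : v ∈ halfspace G w v₀ := Nat.lt_of_succ_le h1.ge
        rw [if_pos m1, if_neg ((hG.notMem_halfspace hw).2 m1)]
        omega
    have e2 := Finset.sum_congr (rfl : (Finset.univ : Finset V) = Finset.univ) (fun v _ => e1 v)
    rw [Finset.sum_add_distrib, Finset.sum_add_distrib, Finset.sum_boole, Finset.sum_boole] at e2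
    have e3 : ∀ s : Set V, (Finset.univ.filter (· ∈ s)).card = s.ncard := fun s => by
      rw [← Set.ncard_coe_finset]
      simp
    rw [e3, e3] at e2
    simp only [Nat.cast_id] at e2
    omega
  have hadd : (halfspace G v₀ w).ncard + (halfspace G w v₀).ncard = Nat.card V := by
    rw [← hG.halfspace_compl hw]
    exact Set.ncard_add_ncard_compl _
  refine lt_of_le_of_ne hle fun heq => ?_
  refine h.unbalanced.2 _ (isThetaClass_iff.2 ⟨v₀, w, hw, rfl⟩) ?_
  rintro H ⟨x, rfl⟩
  have hcard : (side G (thetaClass G s(v₀, w)) x).ncard = (halfspace G v₀ w).ncard := by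
    by_cases hx : x ∈ halfspace G v₀ w
    · rw [hG.side_thetaClass hw hx]
    · rw [show s(v₀, w) = s(w, v₀) from Sym2.eq_swap,
        hG.side_thetaClass hw.symm ((hG.notMem_halfspace hw).1 hx), heq]
  rw [hcard]
  have h3 : (3 : ℝ) ≤ (Nat.card V : ℝ) := by exact_mod_cast h.three_le
  have hlog : 1 < Real.log (Nat.card V) := by
    rw [Real.lt_log_iff_exp_lt (by linarith)]
    linarith [Real.exp_one_lt_d9]
  beta_reduce
  rw [div_le_iff₀ (by linarith)]
  have : (Nat.card V : ℝ) = 2 * (halfspace G v₀ w).ncard := by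
    rw [← hadd, heq]; push_cast; ring
  rw [this] at hlog ⊢
  nlinarith [Nat.cast_nonneg (α := ℝ) (halfspace G v₀ w).ncard]

lemma minorityHalfspace_eq (h : SliceSetting G ω v₀ umax E ℓ) {w : V} (hw : G.Adj v₀ w) :
    minorityHalfspace G (thetaClass G s(v₀, w)) = halfspace G w v₀ := by
  have hG := h.isMedianGraph
  have hlt := h.ncard_halfspace_lt hw
  ext x
  rw [minorityHalfspace, Set.mem_ofPred_eq]
  by_cases hx : x ∈ halfspace G v₀ w
  · rw [hG.side_thetaClass hw hx, hG.halfspace_compl hw, ← hG.notMem_halfspace hw]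
    simp only [hx, not_true_eq_false, iff_false]
    omega
  · rw [hG.notMem_halfspace hw] at hx
    rw [show s(v₀, w) = s(w, v₀) from Sym2.eq_swap, hG.side_thetaClass hw.symm hx,
      hG.halfspace_compl hw.symm]
    simp only [hx, hlt]

lemma exists_neighbor (h : SliceSetting G ω v₀ umax E ℓ) {j : ℕ} (hj : j < ℓ) :
    ∃ w, G.Adj v₀ w ∧ umax ∈ halfspace G w v₀ ∧ E j = thetaClass G s(v₀, w) ∧
      minorityHalfspace G (E j) = halfspace G w v₀ := by
  obtain ⟨hE, hu, e, he, hv⟩ := h.enum.mapsTo hj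
  obtain ⟨w, rfl⟩ := hv
  obtain ⟨hw, hEw⟩ := h.isMedianGraph.thetaClass_eq_of_mem hE he
  rw [hEw] at hu ⊢
  refine ⟨w, hw, ?_, rfl, h.minorityHalfspace_eq hw⟩
  rwa [h.isMedianGraph.side_thetaClass hw (left_mem_halfspace hw),
    h.isMedianGraph.notMem_halfspace hw] at hu

lemma exists_index (h : SliceSetting G ω v₀ umax E ℓ) {w : V} (hw : G.Adj v₀ w)
    (hu : umax ∈ halfspace G w v₀) :
    ∃ j < ℓ, minorityHalfspace G (E j) = halfspace G w v₀ := by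
  have hmem : thetaClass G s(v₀, w) ∈ ladderSet G v₀ umax := by
    refine ⟨isThetaClass_iff.2 ⟨v₀, w, hw, rfl⟩, ?_, s(v₀, w), Relation.ReflTransGen.refl,
      Sym2.mem_mk_left _ _⟩
    rwa [h.isMedianGraph.side_thetaClass hw (left_mem_halfspace hw),
      h.isMedianGraph.notMem_halfspace hw]
  obtain ⟨j, hj, he⟩ := h.enum.surjOn hmem
  exact ⟨j, hj, by rw [he, h.minorityHalfspace_eq hw]⟩

lemma ell_pos (h : SliceSetting G ω v₀ umax E ℓ) : 0 < ℓ := by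
  obtain ⟨w, hw, hd⟩ := exists_adj_dist_succ h.isMedianGraph.1 h.ne.symm
  obtain ⟨j, hj, -⟩ := h.exists_index hw (show umax ∈ halfspace G w v₀ by
    simp only [halfspace, Set.mem_ofPred_eq, G.dist_comm (u := umax)]
    omega)
  omega

lemma center_mem_largeSet (h : SliceSetting G ω v₀ umax E ℓ) {i : ℕ} (hi : i ≤ ℓ) :
    v₀ ∈ largeSet G E i := by
  induction i with
  | zero => trivial
  | succ k ih =>
    obtain ⟨w, hw, -, -, hm⟩ := h.exists_neighbor (j := k) (by omega)
    refine ⟨ih (by omega), ?_⟩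
    rw [hm, h.isMedianGraph.notMem_halfspace hw.symm]
    exact left_mem_halfspace hw

lemma largeSet_convex (h : SliceSetting G ω v₀ umax E ℓ) {i : ℕ} (hi : i ≤ ℓ) :
    IsGeodConvex G (largeSet G E i) := by
  induction i with
  | zero => exact fun _ _ _ _ _ _ => trivial
  | succ k ih =>
    obtain ⟨w, hw, -, -, hm⟩ := h.exists_neighbor (j := k) (by omega)
    rw [largeSet, hm, Set.sdiff_eq, h.isMedianGraph.halfspace_compl hw.symm]
    exact (ih (by omega)).inter (h.isMedianGraph.halfspace_convex hw)

lemma slice_convex (h : SliceSetting G ω v₀ umax E ℓ) {i : ℕ} (hi : i < ℓ) :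
    IsGeodConvex G (slice G E i) := by
  obtain ⟨w, hw, -, -, hm⟩ := h.exists_neighbor hi
  rw [slice_eq_inter, hm]
  exact (h.largeSet_convex hi.le).inter (h.isMedianGraph.halfspace_convex hw.symm)

/-- The neighbour of `v₀` across `E i` is in no minority halfspace of another index: `v₀` has one
neighbour across each class, so that class would equal `E i`, against the injectivity of the
enumeration. -/
lemma exists_mem_slice (h : SliceSetting G ω v₀ umax E ℓ) {i : ℕ} (hi : i < ℓ) :
    ∃ w ∈ slice G E i, G.Adj v₀ w := by
  obtain ⟨w, hw, -, he, hm⟩ := h.exists_neighbor hi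
  refine ⟨w, ?_, hw⟩
  rw [slice_eq_inter, hm]
  refine ⟨?_, left_mem_halfspace hw.symm⟩
  have : ∀ k ≤ i, w ∈ largeSet G E k := by
    intro k hk
    induction k with
    | zero => trivial
    | succ k ih =>
      refine ⟨ih (by omega), ?_⟩
      obtain ⟨w', hw', -, he', hm'⟩ := h.exists_neighbor (j := k) (by omega)
      rw [hm', ← h.isMedianGraph.notMem_halfspace hw']
      intro hin
      have := h.isMedianGraph.crossing_unique hw' hw hw' (left_mem_halfspace hw') hin
        ((h.isMedianGraph.notMem_halfspace hw').2 (left_mem_halfspace hw'.symm))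
      subst this
      have := h.enum.injOn (show k < ℓ by omega) hi (he'.trans he.symm)
      omega
  exact this i le_rfl

/-- Vertices outside all slices have their farthest vertices in the first slice. -/
lemma setEcc_slice_zero (h : SliceSetting G ω v₀ umax E ℓ) {u : V} (hu : u ∈ largeSet G E ℓ) :
    setEcc G (slice G E 0) ω u = wecc G ω u := by
  have hG := h.isMedianGraph
  apply le_antisymm
  · rw [← setEcc_univ]
    exact setEcc_mono (Set.subset_univ _) ω u
  have hmax : umax ∈ slice G E 0 := by
    obtain ⟨w, -, hw, -, hm⟩ := h.exists_neighbor h.ell_pos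
    rw [slice_eq_inter, hm]
    exact ⟨trivial, hw⟩
  refine le_trans ?_ (le_setEcc ω u hmax)
  -- If the median of `u`, `v₀`, `umax` is not `v₀`, the first edge from `v₀` towards it defines a
  -- ladder class with both `u` and `umax` on the far side. But `u` is outside all minority
  -- halfspaces.
  have hbtw : G.dist u v₀ + G.dist v₀ umax = G.dist u umax := by
    obtain ⟨m, h1, h2, h3⟩ := hG.exists_median u v₀ umax
    simp only [mem_interval] at h1 h2 h3
    by_cases hm : v₀ = m
    · subst hm
      rw [G.dist_comm (u := umax) (v := v₀), G.dist_comm (u := umax) (v := u),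
        G.dist_comm (u := v₀) (v := u)] at h3
      omega
    exfalso
    obtain ⟨w, hw, hd⟩ := exists_adj_dist_succ hG.1 hm
    have key : ∀ x, G.dist v₀ m + G.dist m x = G.dist v₀ x → x ∈ halfspace G w v₀ := by
      intro x hx
      have t : G.dist w x ≤ G.dist w m + G.dist m x := hG.1.dist_triangle
      simp only [halfspace, Set.mem_ofPred_eq, G.dist_comm (u := x)]
      omega
    obtain ⟨j, hj, hmin⟩ := h.exists_index hw (key umax h2)
    have hj' := largeSet_antitone (Nat.succ_le_of_lt hj) hu
    refine hj'.2 (hmin ▸ key u ?_)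
    rw [G.dist_comm (u := v₀) (v := m), G.dist_comm (u := m) (v := u),
      G.dist_comm (u := v₀) (v := u)]
    omega
  rw [← setEcc_univ]
  refine setEcc_le fun z _ => ?_
  have h1 : wdist G ω v₀ z ≤ wdist G ω v₀ umax := by
    rw [h.farthest.1, ← setEcc_univ]
    exact le_setEcc ω v₀ (Set.mem_univ z)
  have h2 : G.dist u z ≤ G.dist u v₀ + G.dist v₀ z := hG.1.dist_triangle
  simp only [wdist] at h1 ⊢
  omega

/-- All patterns of membership in the minority halfspaces of the ladder are realized. -/
lemma two_pow_le (h : SliceSetting G ω v₀ umax E ℓ) : 2 ^ ℓ ≤ Nat.card V := by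
  classical
  have hG := h.isMedianGraph
  have hpat : ∀ T : Finset (Fin ℓ), ∃ x : V, ∀ j : Fin ℓ,
      x ∈ minorityHalfspace G (E j) ↔ j ∈ T := by
    intro T
    induction T using Finset.induction_on with
    | empty =>
      refine ⟨v₀, fun j => ?_⟩
      obtain ⟨w, hw, -, -, hm⟩ := h.exists_neighbor j.2
      rw [hm, ← hG.notMem_halfspace hw]
      simp [left_mem_halfspace hw]
    | insert i T _ ih =>
      obtain ⟨x, hx⟩ := ih
      obtain ⟨y, hy, hvy⟩ := h.exists_mem_slice i.2
      -- Convexity of both sides makes membership of a median a majority vote. Here `umax` is in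
      -- every minority halfspace of the ladder and `y` only in that of index `i`, so exactly `i` is
      -- added to the pattern of `x`.
      obtain ⟨m, h1, h2, h3⟩ := hG.exists_median x y umax
      refine ⟨m, fun j => ?_⟩
      obtain ⟨w, hw, hu, he, hm⟩ := h.exists_neighbor j.2
      have hyj : y ∈ minorityHalfspace G (E j) ↔ j = i := by
        rw [slice_eq_inter] at hy
        constructor
        · intro hyj
          obtain ⟨w', hw', -, he', hm'⟩ := h.exists_neighbor i.2
          rw [hm, ← hG.notMem_halfspace hw] at hyj
          have hyi := hy.2
          rw [hm', ← hG.notMem_halfspace hw'] at hyi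
          have e1 := hG.crossing_unique hw hvy hw (left_mem_halfspace hw) hyj
            ((hG.notMem_halfspace hw).2 (left_mem_halfspace hw.symm))
          have e2 := hG.crossing_unique hw' hvy hw' (left_mem_halfspace hw') hyi
            ((hG.notMem_halfspace hw').2 (left_mem_halfspace hw'.symm))
          subst e1 e2
          exact Fin.ext (h.enum.injOn j.2 i.2 (he.trans he'.symm))
        · rintro rfl
          exact hy.2
      rw [Finset.mem_insert, ← hx j, ← hyj]
      rw [hm]
      rw [hm] at hyj
      have hcv := hG.halfspace_convex hw.symm
      constructor
      · intro hmj
        by_contra hno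
        rw [not_or, hG.notMem_halfspace hw.symm, hG.notMem_halfspace hw.symm] at hno
        have := hG.halfspace_convex hw x hno.2 y hno.1 h1
        rw [← hG.notMem_halfspace hw.symm] at this
        exact this hmj
      · rintro (hy' | hx')
        · exact hcv y hy' umax hu h2
        · exact hcv umax hu x hx' h3
  choose f hf using hpat
  have hinj : Function.Injective f := by
    intro S T hST
    ext j
    rw [← hf S j, ← hf T j, hST]
  have := Nat.card_le_card_of_injective f hinj
  simpa using this

end SliceSetting

/-! ## Breadth first search -/

/-- A graph on `{p | p < n}` given by concatenated adjacency lists, the region of the vertices `p`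
with `i ≤ sl p`, the sources being those with `sl p = i`, the distance `D` to the sources within the
region, and a function `F` which grows by one from a vertex to the next vertex on a shortest path
from the sources and takes the values `ecc` on the sources. -/
structure SearchData where
  n : ℕ
  i : ℕ
  off : ℕ → ℕ
  nb : ℕ → ℕ
  sl : ℕ → ℕ
  ecc : ℕ → ℕ
  D : ℕ → ℕ
  F : ℕ → ℕ
  off_zero : off 0 = 0
  off_le : ∀ p < n, off p ≤ off (p + 1)
  nb_lt : ∀ p < n, ∀ k, off p ≤ k → k < off (p + 1) → nb k < n
  D_zero : ∀ p < n, i ≤ sl p → (D p = 0 ↔ sl p = i)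
  D_le : ∀ p < n, i ≤ sl p → ∀ k, off p ≤ k → k < off (p + 1) → i ≤ sl (nb k) →
    D (nb k) ≤ D p + 1
  D_pred : ∀ p < n, i ≤ sl p → ∀ d, D p = d + 1 →
    ∃ x < n, i ≤ sl x ∧ D x = d ∧ ∃ k, off x ≤ k ∧ k < off (x + 1) ∧ nb k = p
  F_source : ∀ p < n, sl p = i → F p = ecc p
  F_succ : ∀ p < n, i ≤ sl p → ∀ k, off p ≤ k → k < off (p + 1) → i ≤ sl (nb k) →
    D (nb k) = D p + 1 → F (nb k) = F p + 1

/-- The state of the search: `q 0, …, q (t-1)` is the queue, `vis` marks the vertices which are in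
the queue or outside the region, and `val` holds the values of `F` on the queue. -/
structure SearchData.QueueInv (S : SearchData) (q vis val : ℕ → ℕ) (t : ℕ) : Prop where
  lt : ∀ j < t, q j < S.n
  region : ∀ j < t, S.i ≤ S.sl (q j)
  inj : ∀ j < t, ∀ j' < t, q j = q j' → j = j'
  vis_eq : ∀ p < S.n, vis p = 0 ↔ S.i ≤ S.sl p ∧ ∀ j < t, q j ≠ p
  sorted : ∀ j j', j ≤ j' → j' < t → S.D (q j) ≤ S.D (q j')
  source : ∀ p < S.n, S.sl p = S.i → ∃ j < t, q j = p
  val_eq : ∀ j < t, val (q j) = S.F (q j)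
  vis_le : ∀ p < S.n, vis p ≤ 1

/-- The entries before `m` of the neighbour list of `x` are in the queue or outside the region. -/
def SearchData.Scanned (S : SearchData) (q : ℕ → ℕ) (t x m : ℕ) : Prop :=
  ∀ k, S.off x ≤ k → k < S.off (x + 1) → k < m → S.i ≤ S.sl (S.nb k) → ∃ j < t, q j = S.nb k

/-- The invariant while the neighbour list of `q c` is scanned. -/
structure SearchData.ScanInv (S : SearchData) (q vis val : ℕ → ℕ) (t c m : ℕ) : Prop
    extends S.QueueInv q vis val t where
  c_lt : c < t
  closed : ∀ j < c, S.Scanned q t (q j) (S.off (q j + 1))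
  current : S.Scanned q t (q c) m
  close : ∀ j < t, S.D (q j) ≤ S.D (q c) + 1

/-- The invariant before `q h` is taken from the queue. -/
structure SearchData.HeadInv (S : SearchData) (q vis val : ℕ → ℕ) (t h : ℕ) : Prop
    extends S.QueueInv q vis val t where
  h_le : h ≤ t
  closed : ∀ j < h, S.Scanned q t (q j) (S.off (q j + 1))
  close : h < t → ∀ j < t, S.D (q j) ≤ S.D (q h) + 1

/-! ### Preservation of the search invariants -/

namespace SearchData

variable {S : SearchData} {q vis val : ℕ → ℕ} {t c m h : ℕ}

lemma QueueInv.t_le (hI : S.QueueInv q vis val t) : t ≤ S.n := by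
  have := Finset.card_le_card_of_injOn (s := Finset.range t) (t := Finset.range S.n) q
    (fun j hj => by simpa using hI.lt j (by simpa using hj))
    (fun j hj j' hj' => hI.inj j (by simpa using hj) j' (by simpa using hj'))
  simpa using this

/-- A predecessor at smaller distance is in the queue by induction, stands before `c` because the
queue is sorted, and hence has had its whole list scanned. -/
lemma ScanInv.mem_queue_of_le (hI : S.ScanInv q vis val t c m) (d : ℕ) :
    ∀ y < S.n, S.i ≤ S.sl y → S.D y = d → d ≤ S.D (q c) → ∃ j < t, q j = y := by
  induction d with
  | zero => exact fun y hy hr hd _ => hI.source y hy ((S.D_zero y hy hr).1 hd)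
  | succ d ih =>
    intro y hy hr hd hle
    obtain ⟨x, hx, hxr, hxd, k, hk1, hk2, rfl⟩ := S.D_pred y hy hr d hd
    obtain ⟨j, hj, rfl⟩ := ih x hx hxr hxd (by omega)
    have hjc : j < c := by
      by_contra hjc
      have := hI.sorted c j (not_lt.1 hjc) hj
      omega
    exact hI.closed j hjc k hk1 hk2 hk2 hr

lemma HeadInv.mem_queue (hI : S.HeadInv q vis val t t) (d : ℕ) :
    ∀ y < S.n, S.i ≤ S.sl y → S.D y = d → ∃ j < t, q j = y := by
  induction d with
  | zero => exact fun y hy hr hd => hI.source y hy ((S.D_zero y hy hr).1 hd)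
  | succ d ih =>
    intro y hy hr hd
    obtain ⟨x, hx, hxr, hxd, k, hk1, hk2, rfl⟩ := S.D_pred y hy hr d hd
    obtain ⟨j, hj, rfl⟩ := ih x hx hxr hxd
    exact hI.closed j hj k hk1 hk2 hk2 hr

lemma HeadInv.scan (hI : S.HeadInv q vis val t h) (hh : h < t) :
    S.ScanInv q vis val t h (S.off (q h)) :=
  { hI.toQueueInv with
    c_lt := hh
    closed := hI.closed
    current := fun _ h1 _ h2 => absurd h1 (not_le.2 h2)
    close := hI.close hh }

lemma ScanInv.next (hI : S.ScanInv q vis val t c (S.off (q c + 1))) :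
    S.HeadInv q vis val t (c + 1) :=
  { hI.toQueueInv with
    h_le := hI.c_lt
    closed := fun j hj => by
      rcases Nat.lt_succ_iff_lt_or_eq.1 hj with h | rfl
      · exact hI.closed j h
      · exact hI.current
    -- By sortedness the new head is at least as far as the old one, so the bound carries over.
    close := fun h j hj =>
      (hI.close j hj).trans (Nat.succ_le_succ (hI.sorted c (c + 1) (Nat.le_succ c) h)) }

lemma ScanInv.skip (hI : S.ScanInv q vis val t c m) (hm1 : S.off (q c) ≤ m)
    (hm2 : m < S.off (q c + 1)) (hv : vis (S.nb m) ≠ 0) : S.ScanInv q vis val t c (m + 1) :=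
  { hI with
    current := fun k h1 h2 h3 h4 => by
      rcases Nat.lt_succ_iff_lt_or_eq.1 h3 with h | rfl
      · exact hI.current k h1 h2 h h4
      · rw [Ne, hI.vis_eq _ (S.nb_lt _ (hI.lt c hI.c_lt) k h1 h2)] at hv
        push Not at hv
        exact hv h4 }

/-- An unmarked vertex is not in the queue, so by `mem_queue_of_le` it is farther than `q c`, and
adjacency makes it farther by exactly one. Appending it keeps the queue sorted, and `F_succ`
justifies the value. -/
lemma ScanInv.discover (hI : S.ScanInv q vis val t c m) (hm1 : S.off (q c) ≤ m)
    (hm2 : m < S.off (q c + 1)) (hv : vis (S.nb m) = 0) :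
    S.ScanInv (Function.update q t (S.nb m)) (Function.update vis (S.nb m) 1)
      (Function.update val (S.nb m) (S.F (q c) + 1)) (t + 1) c (m + 1) := by
  have hc := hI.c_lt
  have hy : S.nb m < S.n := S.nb_lt _ (hI.lt c hc) m hm1 hm2
  obtain ⟨hr, hnew⟩ := (hI.vis_eq _ hy).1 hv
  have hD : S.D (S.nb m) = S.D (q c) + 1 := by
    refine le_antisymm (S.D_le _ (hI.lt c hc) (hI.region c hc) m hm1 hm2 hr) ?_
    by_contra hlt
    obtain ⟨j, hj, he⟩ := hI.mem_queue_of_le _ _ hy hr rfl (by omega)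
    exact hnew j hj he
  have hold : ∀ j < t, Function.update q t (S.nb m) j = q j :=
    fun j hj => Function.update_of_ne hj.ne _ _
  have hlast : Function.update q t (S.nb m) t = S.nb m := Function.update_self _ _ _
  have hcases : ∀ j, j < t + 1 → j < t ∨ j = t := fun j hj => Nat.lt_succ_iff_lt_or_eq.1 hj
  have hscan : ∀ x k, S.Scanned q t x k →
      S.Scanned (Function.update q t (S.nb m)) (t + 1) x k := by
    intro x k hs l h1 h2 h3 h4
    obtain ⟨j, hj, he⟩ := hs l h1 h2 h3 h4
    exact ⟨j, by omega, by rw [hold j hj, he]⟩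
  refine ⟨⟨?_, ?_, ?_, ?_, ?_, ?_, ?_, ?_⟩, by omega, ?_, ?_, ?_⟩
  · intro j hj
    rcases hcases j hj with h | rfl
    · rw [hold j h]; exact hI.lt j h
    · rwa [hlast]
  · intro j hj
    rcases hcases j hj with h | rfl
    · rw [hold j h]; exact hI.region j h
    · rwa [hlast]
  · intro j hj j' hj' he
    rcases hcases j hj with h | rfl <;> rcases hcases j' hj' with h' | rfl
    · rw [hold j h, hold j' h'] at he
      exact hI.inj j h j' h' he
    · rw [hold j h, hlast] at he
      exact absurd he (hnew j h)
    · rw [hold j' h', hlast] at he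
      exact absurd he.symm (hnew j' h')
    · rfl
  · intro p hp
    by_cases hpm : p = S.nb m
    · subst hpm
      rw [Function.update_self]
      simp only [one_ne_zero, false_iff]
      rintro ⟨-, h⟩
      exact h t (by omega) hlast
    · rw [Function.update_of_ne hpm, hI.vis_eq p hp]
      refine and_congr_right fun _ => ⟨fun h j hj => ?_, fun h j hj => ?_⟩
      · rcases hcases j hj with h' | rfl
        · rw [hold j h']; exact h j h'
        · rw [hlast]; exact fun h => hpm h.symm
      · have := h j (by omega)
        rwa [hold j hj] at this
  · intro j j' hjj hj'
    rcases hcases j' hj' with h' | rfl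
    · rw [hold j (by omega), hold j' h']
      exact hI.sorted j j' hjj h'
    · rcases hcases j (by omega) with h | rfl
      · rw [hold j h, hlast, hD]
        exact hI.close j h
      · exact le_rfl
  · intro p hp hs
    obtain ⟨j, hj, he⟩ := hI.source p hp hs
    exact ⟨j, by omega, by rw [hold j hj, he]⟩
  · intro j hj
    rcases hcases j hj with h | rfl
    · rw [hold j h, Function.update_of_ne (hnew j h)]
      exact hI.val_eq j h
    · rw [hlast, Function.update_self]
      exact (S.F_succ _ (hI.lt c hc) (hI.region c hc) m hm1 hm2 hr hD).symm
  · intro p hp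
    by_cases hpm : p = S.nb m
    · rw [hpm, Function.update_self]
    · rw [Function.update_of_ne hpm]; exact hI.vis_le p hp
  · intro j hj
    rw [hold j (by omega)]
    exact hscan _ _ (hI.closed j hj)
  · rw [hold c hc]
    intro k h1 h2 h3 h4
    rcases Nat.lt_succ_iff_lt_or_eq.1 h3 with h | rfl
    · exact hscan _ _ hI.current k h1 h2 h h4
    · exact ⟨t, by omega, hlast⟩
  · intro j hj
    rw [hold c hc]
    rcases hcases j hj with h | rfl
    · rw [hold j h]; exact hI.close j h
    · rw [hlast, hD]

/-- The invariant of the initialization, when the vertices before `p` have been inspected. -/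
structure StartInv (S : SearchData) (q vis val : ℕ → ℕ) (t p : ℕ) : Prop where
  lt : ∀ j < t, q j < p
  source' : ∀ j < t, S.sl (q j) = S.i
  inj : ∀ j < t, ∀ j' < t, q j = q j' → j = j'
  vis_eq : ∀ x < p, vis x = 0 ↔ S.i < S.sl x
  source : ∀ x < p, S.sl x = S.i → ∃ j < t, q j = x
  val_eq : ∀ j < t, val (q j) = S.ecc (q j)
  vis_le : ∀ x < p, vis x ≤ 1

lemma StartInv.t_le {p : ℕ} (hI : S.StartInv q vis val t p) : t ≤ p := by
  have := Finset.card_le_card_of_injOn (s := Finset.range t) (t := Finset.range p) q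
    (fun j hj => by simpa using hI.lt j (by simpa using hj))
    (fun j hj j' hj' => hI.inj j (by simpa using hj) j' (by simpa using hj'))
  simpa using this

/-- Covers later indices, with mark `0`, and earlier ones, with mark `1`: vertices outside the
region count as visited. -/
lemma StartInv.skip {p v : ℕ} (hI : S.StartInv q vis val t p) (hp : S.sl p ≠ S.i)
    (hv : v = 0 ↔ S.i < S.sl p) (hv1 : v ≤ 1) :
    S.StartInv q (Function.update vis p v) val t (p + 1) where
  lt j hj := (hI.lt j hj).trans (Nat.lt_succ_self p)
  source' := hI.source'
  inj := hI.inj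
  vis_eq x hx := by
    rcases Nat.lt_succ_iff_lt_or_eq.1 hx with h | rfl
    · rw [Function.update_of_ne h.ne]; exact hI.vis_eq x h
    · rw [Function.update_self]; exact hv
  source x hx hs := by
    rcases Nat.lt_succ_iff_lt_or_eq.1 hx with h | rfl
    · exact hI.source x h hs
    · exact absurd hs hp
  val_eq := hI.val_eq
  vis_le x hx := by
    rcases Nat.lt_succ_iff_lt_or_eq.1 hx with h | rfl
    · rw [Function.update_of_ne h.ne]; exact hI.vis_le x h
    · rwa [Function.update_self]

lemma StartInv.push {p : ℕ} (hI : S.StartInv q vis val t p) (hp : S.sl p = S.i) :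
    S.StartInv (Function.update q t p) (Function.update vis p 1)
      (Function.update val p (S.ecc p)) (t + 1) (p + 1) := by
  have hold : ∀ j < t, Function.update q t p j = q j :=
    fun j hj => Function.update_of_ne hj.ne _ _
  have hlast : Function.update q t p t = p := Function.update_self _ _ _
  have hcases : ∀ j, j < t + 1 → j < t ∨ j = t := fun j hj => Nat.lt_succ_iff_lt_or_eq.1 hj
  refine ⟨?_, ?_, ?_, ?_, ?_, ?_, ?_⟩
  · intro j hj
    rcases hcases j hj with h | rfl
    · rw [hold j h]; exact (hI.lt j h).trans (Nat.lt_succ_self p)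
    · rw [hlast]; omega
  · intro j hj
    rcases hcases j hj with h | rfl
    · rw [hold j h]; exact hI.source' j h
    · rwa [hlast]
  · intro j hj j' hj' he
    rcases hcases j hj with h | rfl <;> rcases hcases j' hj' with h' | rfl
    · rw [hold j h, hold j' h'] at he
      exact hI.inj j h j' h' he
    · rw [hold j h, hlast] at he
      exact absurd he (hI.lt j h).ne
    · rw [hold j' h', hlast] at he
      exact absurd he.symm (hI.lt j' h').ne
    · rfl
  · intro x hx
    rcases Nat.lt_succ_iff_lt_or_eq.1 hx with h | rfl
    · rw [Function.update_of_ne h.ne]; exact hI.vis_eq x h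
    · rw [Function.update_self]; omega
  · intro x hx hs
    rcases Nat.lt_succ_iff_lt_or_eq.1 hx with h | rfl
    · obtain ⟨j, hj, he⟩ := hI.source x h hs
      exact ⟨j, by omega, by rw [hold j hj, he]⟩
    · exact ⟨t, by omega, hlast⟩
  · intro j hj
    rcases hcases j hj with h | rfl
    · rw [hold j h, Function.update_of_ne (hI.lt j h).ne]; exact hI.val_eq j h
    · rw [hlast, Function.update_self]
  · intro x hx
    rcases Nat.lt_succ_iff_lt_or_eq.1 hx with h | rfl
    · rw [Function.update_of_ne h.ne]; exact hI.vis_le x h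
    · rw [Function.update_self]

lemma startInv_zero : S.StartInv q vis val 0 0 := by
  constructor <;> intro j hj <;> omega

/-- The initial queue consists of sources, all at distance `0`, so it is trivially sorted. -/
lemma StartInv.head (hI : S.StartInv q vis val t S.n) : S.HeadInv q vis val t 0 := by
  have hD : ∀ j < t, S.D (q j) = 0 := fun j hj =>
    (S.D_zero _ (hI.lt j hj) (hI.source' j hj).ge).2 (hI.source' j hj)
  refine ⟨⟨hI.lt, fun j hj => (hI.source' j hj).ge, hI.inj, ?_, ?_, hI.source, ?_,
    hI.vis_le⟩,
    Nat.zero_le _, ?_, ?_⟩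
  · intro p hp
    rw [hI.vis_eq p hp]
    constructor
    · refine fun h => ⟨h.le, ?_⟩
      rintro j hj rfl
      have := hI.source' j hj
      omega
    · rintro ⟨h1, h2⟩
      refine lt_of_le_of_ne h1 fun he => ?_
      obtain ⟨j, hj, hq⟩ := hI.source p hp he.symm
      exact h2 j hj hq
  · intro j j' hjj hj'
    rw [hD j (by omega), hD j' hj']
  · intro j hj
    rw [hI.val_eq j hj, S.F_source _ (hI.lt j hj) (hI.source' j hj)]
  · intro j hj
    omega
  · intro _ j hj
    rw [hD j hj]
    omega

lemma off_mono {p p' : ℕ} (h : p ≤ p') (hp : p' ≤ S.n) : S.off p ≤ S.off p' := by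
  induction p', h using Nat.le_induction with
  | base => exact le_rfl
  | succ k hk ih => exact (ih (by omega)).trans (S.off_le k (by omega))

end SearchData

/-! ## Total correctness with time bounds -/

/-- The program `p` started in `s` halts after a number of steps and in a state that satisfy `Q`. -/
def Runs (W : ℕ) (p : Program) (s : State) (Q : ℕ → State → Prop) : Prop :=
  ∃ t s', Exec W p s t s' ∧ Q t s'

/-- Programs executed one after the other. -/
def Program.block (l : List Program) : Program := l.foldr .seq .skip

section Rules

variable {W : ℕ} {s : State} {Q Q' : ℕ → State → Prop} {p q : Program} {b : Test}

lemma Runs.mono (h : Runs W p s Q) (hQ : ∀ t s', Q t s' → Q' t s') : Runs W p s Q' := by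
  obtain ⟨t, s', he, hq⟩ := h
  exact ⟨t, s', he, hQ t s' hq⟩

lemma runs_block_nil : Runs W (.block []) s Q ↔ Q 1 s := by
  constructor
  · rintro ⟨t, s', he, hq⟩
    cases he
    exact hq
  · exact fun h => ⟨1, s, .skip s, h⟩

lemma runs_instr {c : Instr} : Runs W (.instr c) s Q ↔ c.value s ≤ W ∧ Q 1 (c.run s) := by
  constructor
  · rintro ⟨t, s', he, hq⟩
    cases he with
    | instr _ _ h => exact ⟨h, hq⟩
  · exact fun h => ⟨1, _, .instr c s h.1, h.2⟩

lemma runs_block_cons {l : List Program} : Runs W (.block (p :: l)) s Q ↔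
    Runs W p s (fun t s' => Runs W (.block l) s' (fun t' s'' => Q (t + t') s'')) := by
  constructor
  · rintro ⟨t, s', he, hq⟩
    cases he with
    | seq hp hl => exact ⟨_, _, hp, _, _, hl, hq⟩
  · rintro ⟨t, s', hp, t', s'', hl, hq⟩
    exact ⟨_, _, .seq hp hl, hq⟩

lemma Runs.ite (h1 : b.holds s → Runs W p s (fun t s' => Q (1 + t) s'))
    (h2 : ¬ b.holds s → Runs W q s (fun t s' => Q (1 + t) s')) : Runs W (.ite b p q) s Q := by
  by_cases hb : b.holds s
  · obtain ⟨t, s', he, hq⟩ := h1 hb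
    exact ⟨_, _, .ite_true hb he, hq⟩
  · obtain ⟨t, s', he, hq⟩ := h2 hb
    exact ⟨_, _, .ite_false hb he, hq⟩

/-- Loops, with an invariant `I` and a potential `Φ` that pays for the steps. -/
lemma Runs.loop (I : State → Prop) (Φ : State → ℕ) (hs : I s)
    (hstep : ∀ s, I s → b.holds s → Runs W p s (fun t s' => I s' ∧ 1 + t + Φ s' ≤ Φ s))
    (hQ : ∀ t s', I s' → ¬ b.holds s' → t ≤ Φ s + 1 → Q t s') : Runs W (.loop b p) s Q := by
  have key : ∀ N s, Φ s ≤ N → I s →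
      ∃ t s', Exec W (.loop b p) s t s' ∧ I s' ∧ ¬ b.holds s' ∧ t ≤ Φ s + 1 := by
    intro N
    induction N with
    | zero =>
      intro s hN hI
      by_cases hb : b.holds s
      · obtain ⟨t, s', -, -, ht⟩ := hstep s hI hb
        omega
      · exact ⟨1, s, .loop_false hb, hI, hb, by omega⟩
    | succ N ih =>
      intro s hN hI
      by_cases hb : b.holds s
      · obtain ⟨t, s', he, hI', ht⟩ := hstep s hI hb
        obtain ⟨t', s'', he', hI'', hb'', ht'⟩ := ih s' (by omega) hI'
        exact ⟨_, s'', .loop_true hb he he', hI'', hb'', by omega⟩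
      · exact ⟨1, s, .loop_false hb, hI, hb, by omega⟩
  obtain ⟨t, s', he, hI, hb, ht⟩ := key _ s le_rfl hs
  exact ⟨t, s', he, hQ t s' hI hb ht⟩

end Rules

/-! ## The program for one slice

Array `8` is `vis`, array `9` is `val`, array `10` is the queue, register `6` its length and
register `7` the position of its head. -/

/-- Inspection of the vertex in register `5`. -/
def startBody : Program := .block
  [.instr (.load 9 4 5),
   -- Registers `3` and `4` hold the constants `1` and `0`. The vertex is marked first and unmarked
   -- again only if its slice index exceeds register `1`.
   .instr (.store 8 5 3),
   .ite (.lt 1 9)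
     (.block [.instr (.store 8 5 4)])
     (.ite (.eq 9 1)
       (.block
         [.instr (.store 10 6 5),
          .instr (.add 6 6 3),
          -- Array `5` supplies the starting values of the search, while array `6`, the
          -- eccentricities for `ω_i^*`, goes to the output, where `headBody` takes the maximum of
          -- the two.
          .instr (.load 9 5 5),
          .instr (.store 9 5 9),
          .instr (.load 9 6 5),
          .instr (.store 0 5 9)])
       (.block [])),
   .instr (.add 5 5 3)]

/-- Inspection of the entry in position `reg 5` of the neighbour lists. -/
def scanBody : Program := .block
  [.instr (.load 9 2 5),
   .instr (.load 10 8 9),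
   .ite (.eq 10 4)
     (.block
       [.instr (.store 8 9 3),
        .instr (.store 10 6 9),
        .instr (.add 6 6 3),
        -- Register `12` holds the value of the head plus one, prepared by `headBody`.
        .instr (.store 9 9 12)])
     (.block []),
   .instr (.add 5 5 3)]

/-- Treatment of the vertex at the head of the queue. -/
def headBody : Program := .block
  [.instr (.load 8 10 7),
   .instr (.load 12 9 8),
   .instr (.load 9 0 8),
   .ite (.lt 9 12) (.block [.instr (.store 0 8 12)]) (.block []),
   .instr (.add 12 12 3),
   .instr (.add 7 7 3),
   .instr (.load 5 1 8),
   .instr (.add 10 8 3),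
   .instr (.load 11 1 10),
   .loop (.lt 5 11) scanBody]

/-- The computations for the slice whose index is in register `1`. -/
def stepProgram : Program := .block
  [.instr (.const 3 1),
   .instr (.const 4 0),
   .instr (.const 5 0),
   .instr (.const 6 0),
   .loop (.lt 5 0) startBody,
   .instr (.const 7 0),
   .loop (.lt 7 6) headBody]

/-! ### Correctness and running time of the search program -/

namespace SearchData

/-- The memory holds the data of the search. -/
structure Frame (S : SearchData) (eccs : ℕ → ℕ) (s : State) : Prop where
  reg_zero : s.reg 0 = S.n
  reg_one : s.reg 1 = S.i
  mem_one : s.mem 1 = S.off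
  mem_two : s.mem 2 = S.nb
  mem_four : s.mem 4 = S.sl
  mem_five : s.mem 5 = S.ecc
  mem_six : s.mem 6 = eccs

/-- The data and the auxiliary constants. -/
structure WorkFrame (S : SearchData) (eccs : ℕ → ℕ) (s : State) : Prop
    extends S.Frame eccs s where
  reg_three : s.reg 3 = 1
  reg_four : s.reg 4 = 0

/-- All numbers that occur are small. -/
structure Bounded (S : SearchData) (eccs out : ℕ → ℕ) (W : ℕ) : Prop where
  n_lt : S.n < W
  off_le : S.off S.n ≤ W
  sl_le : ∀ p < S.n, S.sl p ≤ W
  ecc_le : ∀ p < S.n, S.ecc p ≤ W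
  eccs_le : ∀ p < S.n, eccs p ≤ W
  out_le : ∀ p < S.n, out p ≤ W
  F_lt : ∀ p < S.n, S.i ≤ S.sl p → S.F p < W

/-- The output array after the inspection of the vertices before `p`. -/
def startOut (S : SearchData) (eccs out : ℕ → ℕ) (p x : ℕ) : ℕ :=
  if x < p ∧ S.sl x = S.i then eccs x else out x

open Classical in
/-- The output array after the treatment of `q 0, …, q (h-1)`. -/
noncomputable def headOut (S : SearchData) (out q : ℕ → ℕ) (h x : ℕ) : ℕ :=
  if ∃ j < h, q j = x then max (out x) (S.F x) else out x

variable {S : SearchData} {eccs out : ℕ → ℕ} {W : ℕ}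

lemma startOut_succ_of_ne {p : ℕ} (h : S.sl p ≠ S.i) :
    S.startOut eccs out (p + 1) = S.startOut eccs out p := by
  funext x
  simp only [startOut]
  refine if_congr (and_congr_left fun hx => ?_) rfl rfl
  have : x ≠ p := by rintro rfl; exact h hx
  omega

lemma startOut_succ_of_eq {p : ℕ} (h : S.sl p = S.i) :
    S.startOut eccs out (p + 1) = Function.update (S.startOut eccs out p) p (eccs p) := by
  funext x
  by_cases hx : x = p
  · subst hx
    simp [startOut, h]
  · rw [Function.update_of_ne hx]
    simp only [startOut]
    refine if_congr (and_congr_left fun _ => ?_) rfl rfl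
    omega

lemma headOut_zero (q : ℕ → ℕ) : S.headOut out q 0 = out := by
  funext x
  simp [headOut]

lemma headOut_succ (q : ℕ → ℕ) (h : ℕ) : S.headOut out q (h + 1) =
    Function.update (S.headOut out q h) (q h) (max (out (q h)) (S.F (q h))) := by
  funext x
  by_cases hx : x = q h
  · subst hx
    rw [Function.update_self, headOut, if_pos ⟨h, Nat.lt_succ_self h, rfl⟩]
  · rw [Function.update_of_ne hx]
    simp only [headOut]
    refine if_congr ⟨?_, ?_⟩ rfl rfl
    · rintro ⟨j, hj, rfl⟩
      refine ⟨j, lt_of_le_of_ne (Nat.le_of_lt_succ hj) ?_, rfl⟩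
      rintro rfl
      exact hx rfl
    · rintro ⟨j, hj, rfl⟩
      exact ⟨j, by omega, rfl⟩

lemma headOut_congr {q q' : ℕ → ℕ} {h : ℕ} (hq : ∀ j < h, q j = q' j) :
    S.headOut out q h = S.headOut out q' h := by
  funext x
  simp only [headOut]
  refine if_congr ⟨?_, ?_⟩ rfl rfl
  · rintro ⟨j, hj, he⟩
    exact ⟨j, hj, (hq j hj) ▸ he⟩
  · rintro ⟨j, hj, he⟩
    exact ⟨j, hj, (hq j hj).trans he⟩

lemma WorkFrame.congr {s s' : State} (h : S.WorkFrame eccs s)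
    (hr : s'.reg 0 = s.reg 0 ∧ s'.reg 1 = s.reg 1 ∧ s'.reg 3 = s.reg 3 ∧ s'.reg 4 = s.reg 4)
    (hm : s'.mem 1 = s.mem 1 ∧ s'.mem 2 = s.mem 2 ∧ s'.mem 4 = s.mem 4 ∧ s'.mem 5 = s.mem 5 ∧
      s'.mem 6 = s.mem 6) : S.WorkFrame eccs s' :=
  ⟨⟨hr.1.trans h.reg_zero, hr.2.1.trans h.reg_one, hm.1.trans h.mem_one, hm.2.1.trans h.mem_two,
    hm.2.2.1.trans h.mem_four, hm.2.2.2.1.trans h.mem_five, hm.2.2.2.2.trans h.mem_six⟩,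
    hr.2.2.1.trans h.reg_three, hr.2.2.2.trans h.reg_four⟩

/-- The invariant of the first loop. -/
structure StartState (S : SearchData) (eccs out : ℕ → ℕ) (s : State) : Prop
    extends S.WorkFrame eccs s where
  le : s.reg 5 ≤ S.n
  inv : S.StartInv (s.mem 10) (s.mem 8) (s.mem 9) (s.reg 6) (s.reg 5)
  out_eq : s.mem 0 = S.startOut eccs out (s.reg 5)

lemma runs_startBody (hB : S.Bounded eccs out W) {s : State} (hI : S.StartState eccs out s)
    (hb : s.reg 5 < S.n) : Runs W startBody s
      (fun t s' => S.StartState eccs out s' ∧ s'.reg 5 = s.reg 5 + 1 ∧ t ≤ 14) := by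
  have ht := hI.inv.t_le
  have hn := hB.n_lt
  have hsl := hB.sl_le _ hb
  have hecc := hB.ecc_le _ hb
  have heccs := hB.eccs_le _ hb
  have e1 := hI.reg_one
  have e3 := hI.reg_three
  have e4 := hI.reg_four
  have m4 := hI.mem_four
  have m5 := hI.mem_five
  have m6 := hI.mem_six
  simp only [startBody, runs_block_cons, runs_instr, Instr.value, Instr.run]
  refine ⟨by simpa [m4] using hsl, by simp [e3]; omega, ?_⟩
  apply Runs.ite
  · intro hlt
    simp [Test.holds, e1, m4] at hlt
    simp [runs_block_cons, runs_block_nil, runs_instr, Instr.value, Instr.run, e3, e4]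
    refine ⟨by omega, hI.toWorkFrame.congr (by simp) (by simp), ?_, ?_, ?_⟩
    · simpa using hb
    · simpa using hI.inv.skip hlt.ne' (v := 0) (by simpa using hlt) zero_le_one
    · simpa [startOut_succ_of_ne hlt.ne'] using hI.out_eq
  · intro hlt
    simp [Test.holds, e1, m4] at hlt
    apply Runs.ite
    · intro heq
      simp [Test.holds, e1, m4] at heq
      simp [runs_block_cons, runs_block_nil, runs_instr, Instr.value, Instr.run, e3, m5, m6]
      refine ⟨by omega, by omega, by omega, by omega, by omega,
        hI.toWorkFrame.congr (by simp) (by simp), ?_, ?_, ?_⟩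
      · simpa using hb
      · simpa using hI.inv.push heq
      · simp [startOut_succ_of_eq heq, hI.out_eq]
    · intro heq
      simp [Test.holds, e1, m4] at heq
      simp [runs_block_nil, e3]
      refine ⟨by omega, hI.toWorkFrame.congr (by simp) (by simp), ?_, ?_, ?_⟩
      · simpa using hb
      · simpa using hI.inv.skip heq (v := 1) (by simpa using hlt) le_rfl
      · simpa [startOut_succ_of_ne heq] using hI.out_eq

/-- The state of the memory while the neighbour list of `s.mem 10 c` is scanned; `q₀` is the queue
at the beginning of the scan. -/
structure ScanState (S : SearchData) (eccs out : ℕ → ℕ) (q₀ : ℕ → ℕ) (c : ℕ) (s : State) : Prop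
    extends S.WorkFrame eccs s where
  inv : S.ScanInv (s.mem 10) (s.mem 8) (s.mem 9) (s.reg 6) c (s.reg 5)
  -- The output of the head is written and register `7` advanced before its list is scanned, hence
  -- `c + 1` here and in `head`.
  out_eq : s.mem 0 = S.headOut out (s.mem 10) (c + 1)
  head : s.reg 7 = c + 1
  reg_eleven : s.reg 11 = S.off (q₀ c + 1)
  reg_twelve : s.reg 12 = S.F (q₀ c) + 1
  ge : S.off (q₀ c) ≤ s.reg 5
  le : s.reg 5 ≤ S.off (q₀ c + 1)
  queue : ∀ j ≤ c, s.mem 10 j = q₀ j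

lemma runs_scanBody {q₀ : ℕ → ℕ} (hB : S.Bounded eccs out W) {c : ℕ} {s : State}
    (hI : S.ScanState eccs out q₀ c s) (hb : s.reg 5 < S.off (q₀ c + 1)) : Runs W scanBody s
      (fun t s' => S.ScanState eccs out q₀ c s' ∧ s'.reg 5 = s.reg 5 + 1 ∧ t ≤ 10) := by
  have hc := hI.inv.c_lt
  have hqc : s.mem 10 c = q₀ c := hI.queue c le_rfl
  have hx : q₀ c < S.n := hqc ▸ hI.inv.lt c hc
  have hxr : S.i ≤ S.sl (q₀ c) := hqc ▸ hI.inv.region c hc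
  have hn := hB.n_lt
  have hF := hB.F_lt _ hx hxr
  have hoff : S.off (q₀ c + 1) ≤ S.off S.n := off_mono hx le_rfl
  have hoffn := hB.off_le
  have hy := S.nb_lt _ hx _ hI.ge hb
  have ht := hI.inv.t_le
  have e3 := hI.reg_three
  have e4 := hI.reg_four
  have e12 := hI.reg_twelve
  have m2 := hI.mem_two
  have hvis : s.mem 8 (S.nb (s.reg 5)) ≤ W := by
    have := hI.inv.vis_le _ hy
    omega
  simp only [scanBody, runs_block_cons, runs_instr, Instr.value, Instr.run]
  refine ⟨by simp [m2]; omega, by simpa [m2] using hvis, ?_⟩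
  apply Runs.ite
  · intro heq
    simp [Test.holds, e4, m2] at heq
    have hd := hI.inv.discover (by rw [hqc]; exact hI.ge) (by rw [hqc]; exact hb) heq
    have ht' := hd.t_le
    simp [runs_block_cons, runs_block_nil, runs_instr, Instr.value, Instr.run, e3, e12, m2]
    refine ⟨by omega, by omega, by omega, by omega, by omega,
      hI.toWorkFrame.congr (by simp) (by simp), ?_, ?_, ?_, ?_, ?_, ?_, ?_, ?_⟩
    · simpa [hqc] using hd
    · simp only [Function.update_of_ne, ne_eq, OfNat.zero_ne_ofNat, not_false_eq_true, hI.out_eq]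
      apply headOut_congr
      intro j hj
      simp [show j ≠ s.reg 6 by omega]
    · simpa using hI.head
    · simpa using hI.reg_eleven
    · simpa using hI.reg_twelve
    · simpa using hI.ge.trans (Nat.le_succ _)
    · simpa using hb
    · intro j hj
      simpa [show j ≠ s.reg 6 by omega] using hI.queue j hj
  · intro hne
    simp [Test.holds, e4, m2] at hne
    simp [runs_block_nil, e3]
    refine ⟨by omega, hI.toWorkFrame.congr (by simp) (by simp), ?_, ?_, ?_, ?_, ?_, ?_, ?_, ?_⟩
    · simpa using hI.inv.skip (by rw [hqc]; exact hI.ge) (by rw [hqc]; exact hb) hne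
    · simpa using hI.out_eq
    · simpa using hI.head
    · simpa using hI.reg_eleven
    · simpa using hI.reg_twelve
    · simpa using hI.ge.trans (Nat.le_succ _)
    · simpa using hb
    · simpa using hI.queue

/-- The state of the memory before `s.mem 10 (s.reg 7)` is treated. -/
structure HeadState (S : SearchData) (eccs out : ℕ → ℕ) (s : State) : Prop
    extends S.WorkFrame eccs s where
  inv : S.HeadInv (s.mem 10) (s.mem 8) (s.mem 9) (s.reg 6) (s.reg 7)
  out_eq : s.mem 0 = S.headOut out (s.mem 10) (s.reg 7)

lemma runs_headBody (hB : S.Bounded eccs out W) {s : State} (hI : S.HeadState eccs out s)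
    (hb : s.reg 7 < s.reg 6) : Runs W headBody s
      (fun t s' => S.HeadState eccs out s' ∧ s'.reg 7 = s.reg 7 + 1 ∧
        (∀ j ≤ s.reg 7, s'.mem 10 j = s.mem 10 j) ∧
        t ≤ 15 + 11 * (S.off (s.mem 10 (s.reg 7) + 1) - S.off (s.mem 10 (s.reg 7)))) := by
  set c := s.reg 7 with hc
  set x := s.mem 10 c with hxdef
  have hx : x < S.n := hI.inv.lt c hb
  have hxr : S.i ≤ S.sl x := hI.inv.region c hb
  have hn := hB.n_lt
  have hF := hB.F_lt _ hx hxr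
  have hoff : S.off (x + 1) ≤ S.off S.n := off_mono hx le_rfl
  have hoff' : S.off x ≤ S.off (x + 1) := S.off_le x hx
  have hoffn := hB.off_le
  have ht := hI.inv.t_le
  have e3 := hI.reg_three
  have m1 := hI.mem_one
  have hval : s.mem 9 x = S.F x := hI.inv.val_eq c hb
  -- Queue entries are distinct, so the output at `x` has not been touched yet.
  have hout : s.mem 0 x = out x := by
    rw [hI.out_eq, headOut, if_neg]
    rintro ⟨j, hj, he⟩
    have := hI.inv.inj j (by omega) c hb he
    omega
  have hox := hB.out_le x hx
  simp only [headBody, runs_block_cons, runs_instr, Instr.value, Instr.run]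
  refine ⟨by simp [← hc, ← hxdef]; omega, by simp [← hc, ← hxdef, hval]; omega,
    by simp [← hc, ← hxdef, hout]; omega, ?_⟩
  -- Both branches are described by one state: when nothing is stored, the maximum is the old value
  -- and the update changes nothing.
  refine Runs.mono (Q := fun t s' => t ≤ 3 ∧ s' = ⟨Function.update (Function.update
    (Function.update s.reg 8 x) 12 (S.F x)) 9 (out x),
    Function.update s.mem 0 (Function.update (s.mem 0) x (max (out x) (S.F x)))⟩) ?_ ?_
  · apply Runs.ite
    · intro hlt
      simp [Test.holds, ← hc, ← hxdef, hval, hout] at hlt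
      simp [runs_block_cons, runs_block_nil, runs_instr, Instr.value, Instr.run, ← hc, ← hxdef,
        hval, hout, max_eq_right hlt.le]
      omega
    · intro hlt
      simp [Test.holds, ← hc, ← hxdef, hval, hout] at hlt
      simp [runs_block_nil, ← hc, ← hxdef, hval, hout, max_eq_left hlt]
  rintro t₁ _ ⟨ht₁, rfl⟩
  simp [e3, m1, ← hc]
  refine ⟨by omega, by omega, by omega, by omega, by omega, ?_⟩
  -- Each list entry pays ten steps for `scanBody` and one for the test.
  refine Runs.loop (S.ScanState eccs out (s.mem 10) c)
    (fun s' => 11 * (S.off (x + 1) - s'.reg 5)) ?_ ?_ ?_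
  · refine ⟨hI.toWorkFrame.congr (by simp) (by simp), ?_, ?_, ?_, ?_, ?_, ?_, ?_, ?_⟩
    · simpa using hI.inv.scan hb
    · simp [hI.out_eq, headOut_succ, ← hc, ← hxdef]
    · simp
    · simp [← hxdef]
    · simp [← hxdef]
    · simp [← hxdef]
    · simpa [← hxdef] using hoff'
    · simp
  · intro s' hI' hb'
    simp only [Test.holds, hI'.reg_eleven] at hb'
    refine (runs_scanBody hB hI' hb').mono ?_
    rintro t s'' ⟨h1, h2, h3⟩
    refine ⟨h1, ?_⟩
    rw [← hxdef] at hb'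
    omega
  · intro t s' hI' hb' ht'
    simp only [Test.holds, hI'.reg_eleven] at hb'
    have hle := hI'.le
    have hq := hI'.queue c le_rfl
    have h5 : s'.reg 5 = S.off (s'.mem 10 c + 1) := by
      rw [hq]
      omega
    have hinv := hI'.inv
    rw [h5] at hinv
    rw [runs_block_nil]
    refine ⟨⟨hI'.toWorkFrame, ?_, ?_⟩, hI'.head, hI'.queue, ?_⟩
    · rw [hI'.head]
      exact hinv.next
    · rw [hI'.head]
      exact hI'.out_eq
    · simp at ht'
      omega

/-- The vertices which are not among `q 0, …, q (h-1)`. -/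
def remaining (S : SearchData) (q : ℕ → ℕ) (h : ℕ) : Finset ℕ :=
  Finset.range S.n \ (Finset.range h).image q

/-- The time for the vertices which are not among `q 0, …, q (h-1)`. -/
def remainingTime (S : SearchData) (q : ℕ → ℕ) (h : ℕ) : ℕ :=
  ∑ p ∈ S.remaining q h, (16 + 11 * (S.off (p + 1) - S.off p))

/-- Distinctness of the queue entries means that a vertex is charged once. Summing over vertices not
yet treated, rather than over the queue, bounds the total before it is known which vertices will be
discovered. -/
lemma remainingTime_succ {q vis val : ℕ → ℕ} {t h : ℕ} (hI : S.QueueInv q vis val t) (hh : h < t) :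
    S.remainingTime q (h + 1) + (16 + 11 * (S.off (q h + 1) - S.off (q h))) =
      S.remainingTime q h := by
  have hmem : q h ∈ S.remaining q h := by
    simp only [remaining, Finset.mem_sdiff, Finset.mem_range, Finset.mem_image, not_exists, not_and]
    refine ⟨hI.lt h hh, fun j hj he => ?_⟩
    have := hI.inj j (by omega) h hh he
    omega
  have herase : S.remaining q (h + 1) = (S.remaining q h).erase (q h) := by
    ext y
    simp only [remaining, Finset.range_add_one, Finset.image_insert, Finset.mem_sdiff,
      Finset.mem_insert, Finset.mem_erase]
    tauto
  rw [remainingTime, herase, Finset.sum_erase_add _ _ hmem, remainingTime]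

/-- The potential depends only on the treated part of the queue, so appending during a scan does not
change it. -/
lemma remainingTime_congr {q q' : ℕ → ℕ} {h : ℕ} (hq : ∀ j < h, q' j = q j) :
    S.remainingTime q' h = S.remainingTime q h := by
  have : (Finset.range h).image q' = (Finset.range h).image q :=
    Finset.image_congr fun j hj => hq j (by simpa using hj)
  rw [remainingTime, remainingTime, remaining, remaining, this]

lemma remainingTime_zero (q : ℕ → ℕ) :
    S.remainingTime q 0 = 16 * S.n + 11 * S.off S.n := by
  have : ∀ m ≤ S.n, ∑ p ∈ Finset.range m, (16 + 11 * (S.off (p + 1) - S.off p)) =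
      16 * m + 11 * S.off m := by
    intro m
    induction m with
    | zero => simp [S.off_zero]
    | succ m ih =>
      intro hm
      have := S.off_le m hm
      rw [Finset.sum_range_succ, ih (by omega)]
      omega
  simpa [remainingTime, remaining] using this S.n le_rfl

lemma Bounded.startOut (hB : S.Bounded eccs out W) (p : ℕ) :
    S.Bounded eccs (S.startOut eccs out p) W :=
  { hB with
    out_le := fun x hx => by
      rw [SearchData.startOut]
      split_ifs
      · exact hB.eccs_le x hx
      · exact hB.out_le x hx }

/-- The output array after the computations for one slice. -/
def stepOut (S : SearchData) (eccs out : ℕ → ℕ) (x : ℕ) : ℕ :=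
  if S.i ≤ S.sl x then max (if S.sl x = S.i then eccs x else out x) (S.F x) else out x

theorem runs_stepProgram (hB : S.Bounded eccs out W) {s : State} (hs : S.Frame eccs s)
    (hout : s.mem 0 = out) : Runs W stepProgram s
      (fun t s' => S.WorkFrame eccs s' ∧ (∀ x < S.n, s'.mem 0 x = S.stepOut eccs out x) ∧
        t ≤ 32 * (S.n + S.off S.n + 1)) := by
  have hn := hB.n_lt
  simp only [stepProgram, runs_block_cons, runs_instr, Instr.value, Instr.run]
  refine ⟨by omega, by omega, by omega, by omega, ?_⟩
  refine Runs.loop (S.StartState eccs out) (fun s' => 15 * (S.n - s'.reg 5)) ?_ ?_ ?_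
  · refine ⟨⟨⟨by simpa using hs.reg_zero, by simpa using hs.reg_one, hs.mem_one, hs.mem_two,
      hs.mem_four, hs.mem_five, hs.mem_six⟩, by simp, by simp⟩, by simp, ?_, ?_⟩
    · simpa using startInv_zero
    · funext x
      simp [hout, startOut]
  · intro s' hI hb
    simp only [Test.holds, hI.reg_zero] at hb
    refine (runs_startBody hB hI hb).mono ?_
    rintro t s'' ⟨h1, h2, h3⟩
    exact ⟨h1, by omega⟩
  intro t₁ s₁ hI₁ hb₁ ht₁
  simp only [Test.holds, hI₁.reg_zero] at hb₁
  have h5 : s₁.reg 5 = S.n := le_antisymm hI₁.le (not_lt.1 hb₁)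
  refine ⟨by omega, ?_⟩
  -- The first loop has overwritten the output at the sources, so the second loop works with a new
  -- initial output.
  have hB' := hB.startOut S.n
  refine Runs.loop (S.HeadState eccs (S.startOut eccs out S.n))
    (fun s' => S.remainingTime (s'.mem 10) (s'.reg 7)) ?_ ?_ ?_
  · refine ⟨hI₁.toWorkFrame.congr (by simp) (by simp), ?_, ?_⟩
    · have := hI₁.inv
      rw [h5] at this
      simpa using this.head
    · simp [headOut_zero, hI₁.out_eq, h5]
  · intro s' hI hb
    simp only [Test.holds] at hb
    refine (runs_headBody hB' hI hb).mono ?_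
    rintro t s'' ⟨h1, h2, h3, h4⟩
    refine ⟨h1, ?_⟩
    have e1 := remainingTime_succ hI.inv.toQueueInv hb
    have e2 : S.remainingTime (s''.mem 10) (s'.reg 7 + 1) =
      S.remainingTime (s'.mem 10) (s'.reg 7 + 1) :=
        remainingTime_congr fun j hj => h3 j (Nat.le_of_lt_succ hj)
    rw [h2]
    omega
  intro t₂ s₂ hI₂ hb₂ ht₂
  simp only [Test.holds] at hb₂
  have h7 : s₂.reg 7 = s₂.reg 6 := le_antisymm hI₂.inv.h_le (not_lt.1 hb₂)
  rw [runs_block_nil]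
  refine ⟨hI₂.toWorkFrame, ?_, ?_⟩
  · intro x hx
    have hinv := hI₂.inv
    rw [h7] at hinv
    rw [hI₂.out_eq, headOut, stepOut, h7]
    by_cases hr : S.i ≤ S.sl x
    · rw [if_pos (hinv.mem_queue _ x hx hr rfl), if_pos hr, startOut]
      simp only [hx, true_and]
    · rw [if_neg, if_neg hr, startOut, if_neg]
      · rintro ⟨-, h⟩
        omega
      · rintro ⟨j, hj, rfl⟩
        exact hr (hinv.region j hj)
  · simp only [Function.update_self, remainingTime_zero] at ht₂
    simp at ht₁
    omega

end SearchData

/-! ## The number of edges -/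

open Classical in
/-- Subgraphs of median graphs with `m` vertices have average degree at most `2 log₂ m`. -/
lemma IsMedianGraph.sum_degree_le (hG : IsMedianGraph G) (k : ℕ) : ∀ X : Finset V, X.card = k →
    ∑ x ∈ X, (X.filter (G.Adj x)).card ≤ 2 * (X.card * Nat.log 2 X.card) := by
  induction k using Nat.strong_induction_on with
  | _ k ih =>
  rintro X rfl
  by_cases hedge : ∃ u ∈ X, ∃ v ∈ X, G.Adj u v
  swap
  · push Not at hedge
    rw [Finset.sum_eq_zero]
    · exact Nat.zero_le _
    · intro x hx
      rw [Finset.card_eq_zero, Finset.filter_eq_empty_iff]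
      exact hedge x hx
  obtain ⟨u, hu, v, hv, huv⟩ := hedge
  set A := X.filter (· ∈ halfspace G u v) with hA
  set B := X.filter (· ∉ halfspace G u v) with hB
  have hAB : A.card + B.card = X.card := Finset.card_filter_add_card_filter_not _
  have hA1 : 1 ≤ A.card := Finset.card_pos.2 ⟨u, by simp [hA, hu, left_mem_halfspace huv]⟩
  have hB1 : 1 ≤ B.card := Finset.card_pos.2 ⟨v, by
    simp [hB, hv, hG.notMem_halfspace huv, left_mem_halfspace huv.symm]⟩
  have hsplit : ∀ x, (X.filter (G.Adj x)).card =
      (A.filter (G.Adj x)).card + (B.filter (G.Adj x)).card := by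
    intro x
    rw [hA, hB, Finset.filter_comm, Finset.filter_comm (s := X) (p := (· ∉ halfspace G u v)),
      Finset.card_filter_add_card_filter_not]
  -- The edges between the two parts form a matching; counted from either side, their number is at
  -- most the smaller cardinality.
  have hcrossA : ∑ x ∈ A, (B.filter (G.Adj x)).card ≤ A.card := by
    rw [Finset.card_eq_sum_ones]
    refine Finset.sum_le_sum fun x hx => Finset.card_le_one.2 ?_
    simp only [hA, hB, Finset.mem_filter] at hx ⊢
    exact fun y hy z hz => hG.crossing_unique huv hy.2 hz.2 hx.2 hy.1.2 hz.1.2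
  have hcrossB : ∑ x ∈ B, (A.filter (G.Adj x)).card ≤ B.card := by
    rw [Finset.card_eq_sum_ones]
    refine Finset.sum_le_sum fun x hx => Finset.card_le_one.2 ?_
    simp only [hA, hB, Finset.mem_filter, hG.notMem_halfspace huv] at hx ⊢
    exact fun y hy z hz => hG.crossing_unique huv.symm hy.2 hz.2 hx.2
      ((hG.notMem_halfspace huv.symm).2 hy.1.2) ((hG.notMem_halfspace huv.symm).2 hz.1.2)
  have hcross : ∑ x ∈ A, (B.filter (G.Adj x)).card = ∑ x ∈ B, (A.filter (G.Adj x)).card := by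
    have := Finset.sum_card_bipartiteAbove_eq_sum_card_bipartiteBelow (s := A) (t := B) G.Adj
    simpa [Finset.bipartiteAbove, Finset.bipartiteBelow, G.adj_comm] using this
  have iA := ih A.card (by omega) A rfl
  have iB := ih B.card (by omega) B rfl
  have hsum : ∑ x ∈ X, (X.filter (G.Adj x)).card = ∑ x ∈ A, (A.filter (G.Adj x)).card +
      ∑ x ∈ B, (B.filter (G.Adj x)).card + 2 * ∑ x ∈ A, (B.filter (G.Adj x)).card := by
    rw [← Finset.sum_filter_add_sum_filter_not X (· ∈ halfspace G u v)]
    simp only [hsplit, Finset.sum_add_distrib]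
    rw [← hA, ← hB]
    omega
  -- For `a ≤ b` one has `2 * a ≤ a + b`, so the logarithm of the smaller part gains at least one,
  -- which pays for the matching.
  have arith : ∀ a b : ℕ, 1 ≤ a → a ≤ b →
      a * Nat.log 2 a + b * Nat.log 2 b + a ≤ (a + b) * Nat.log 2 (a + b) := by
    intro a b ha hab
    have h1 : Nat.log 2 a + 1 ≤ Nat.log 2 (a + b) := by
      rw [← Nat.log_mul_base one_lt_two (by omega)]
      exact Nat.log_mono_right (by omega)
    have h2 : Nat.log 2 b ≤ Nat.log 2 (a + b) := Nat.log_mono_right (by omega)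
    calc a * Nat.log 2 a + b * Nat.log 2 b + a = a * (Nat.log 2 a + 1) + b * Nat.log 2 b := by ring
      _ ≤ a * Nat.log 2 (a + b) + b * Nat.log 2 (a + b) := by gcongr
      _ = _ := by ring
  rw [hsum, ← hAB]
  rcases le_total A.card B.card with h | h
  · have := arith _ _ hA1 h
    omega
  · have := arith _ _ hB1 h
    rw [add_comm B.card] at this
    omega

/-! ## Adjacency lists in memory -/

namespace AdjLists

variable (A : AdjLists G)

/-- Beginning of the neighbour list of vertex number `p`. -/
def off (p : ℕ) : ℕ := (A.rows.take p).flatten.length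

/-- The concatenation of the neighbour lists. -/
def nb (p : ℕ) : ℕ := A.rows.flatten.getD p 0

lemma exists_num {p : ℕ} (hp : p < A.size) : ∃ v, (A.num v : ℕ) = p :=
  ⟨A.num.symm ⟨p, hp⟩, by simp⟩

lemma vertexArray_num (f : V → ℕ) (v : V) : A.vertexArray f (A.num v) = f v := by
  simp [vertexArray]

lemma length_rows : A.rows.length = A.size := by simp [rows]

lemma rows_getElem (v : V) (h : (A.num v : ℕ) < A.rows.length) :
    A.rows[(A.num v : ℕ)] = (A.nbrs v).map fun w => (A.num w : ℕ) := by
  simp [rows]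

lemma off_succ (v : V) : A.off (A.num v + 1) = A.off (A.num v) + (A.nbrs v).length := by
  have h : (A.num v : ℕ) < A.rows.length := by
    rw [A.length_rows]
    exact (A.num v).2
  rw [off, off, List.take_succ_eq_append_getElem h, A.rows_getElem]
  simp

lemma nb_off_add (v : V) {j : ℕ} (hj : j < (A.nbrs v).length) :
    A.nb (A.off (A.num v) + j) = A.num (A.nbrs v)[j] := by
  have h : (A.num v : ℕ) < A.rows.length := by
    rw [A.length_rows]
    exact (A.num v).2
  have hsplit : A.rows.flatten = (A.rows.take (A.num v)).flatten ++
      ((A.nbrs v).map fun w => (A.num w : ℕ)) ++ (A.rows.drop (A.num v + 1)).flatten := by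
    conv_lhs => rw [← List.take_append_drop (A.num v : ℕ) A.rows, List.drop_eq_getElem_cons h,
      A.rows_getElem]
    simp
  rw [nb, hsplit, List.append_assoc, off, List.getD_append_right _ _ _ _ (Nat.le_add_right _ _),
    Nat.add_sub_cancel_left, List.getD_append _ _ _ _ (by simpa using hj)]
  rw [List.getD_eq_getElem _ _ (by simpa using hj)]
  simp

lemma exists_nb {v : V} {k : ℕ} (h1 : A.off (A.num v) ≤ k) (h2 : k < A.off (A.num v + 1)) :
    ∃ w, G.Adj v w ∧ A.nb k = A.num w := by
  obtain ⟨j, rfl⟩ := Nat.exists_eq_add_of_le h1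
  rw [off_succ] at h2
  have hj : j < (A.nbrs v).length := by omega
  exact ⟨_, (A.mem_nbrs v _).1 (List.getElem_mem hj), A.nb_off_add v hj⟩

lemma exists_off {v w : V} (h : G.Adj v w) :
    ∃ k, A.off (A.num v) ≤ k ∧ k < A.off (A.num v + 1) ∧ A.nb k = A.num w := by
  obtain ⟨j, hj, rfl⟩ := List.mem_iff_getElem.1 ((A.mem_nbrs v w).2 h)
  exact ⟨_, Nat.le_add_right _ j, by rw [off_succ]; omega, A.nb_off_add v hj⟩

lemma size_eq : A.size = Nat.card V := by simp [Nat.card_congr A.num]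

open Classical in
lemma off_size [Fintype V] : A.off A.size = ∑ v, G.degree v := by
  have hlen : ∀ v, (A.nbrs v).length = G.degree v := by
    intro v
    rw [← List.toFinset_card_of_nodup (A.nodup v), ← G.card_neighborFinset_eq_degree]
    congr 1
    ext w
    simp [A.mem_nbrs]
  rw [off, ← A.length_rows, List.take_length, List.length_flatten, rows, List.map_map]
  simp only [← hlen]
  rw [← Equiv.sum_comp A.num.symm, Fin.sum_univ_def]
  congr 1
  refine List.map_congr_left fun p _ => ?_
  simp

lemma off_size_eq_two_mul [Finite V] : A.off A.size = 2 * G.edgeSet.ncard := by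
  classical
  have := Fintype.ofFinite V
  rw [off_size, G.sum_degrees_eq_twice_card_edges, ← SimpleGraph.coe_edgeFinset,
    Set.ncard_coe_finset]

lemma off_size_le [Finite V] (hG : IsMedianGraph G) :
    A.off A.size ≤ 2 * (Nat.card V * Nat.log 2 (Nat.card V)) := by
  classical
  have := Fintype.ofFinite V
  rw [off_size, Nat.card_eq_fintype_card]
  refine le_trans (le_of_eq ?_) (hG.sum_degree_le _ Finset.univ rfl)
  refine Finset.sum_congr rfl fun v _ => ?_
  rw [← G.card_neighborFinset_eq_degree]
  congr 1
  ext w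
  simp

end AdjLists

variable {ω : V → ℕ}

/-! ## The recursion for the labels -/

open Classical in
/-- The output of the algorithm after the slices of index at least `i`: the labels `B_i`, and on
`G_ℓ` the largest weighted distances to vertices of the slices of index at least `i`. -/
noncomputable def target (G : SimpleGraph V) (ω : V → ℕ) (E : ℕ → Set (Sym2 V)) (ℓ i : ℕ) (u : V) :
    ℕ :=
  if i ≤ sliceIndex G E ℓ u then
    setEcc G (if sliceIndex G E ℓ u < ℓ then largeSet G E i
      else largeSet G E i \ largeSet G E ℓ) ω u
  else 0

lemma slice_subset_largeSet (i : ℕ) : slice G E i ⊆ largeSet G E i := Set.sdiff_subset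

lemma largeSet_eq_union (i : ℕ) : largeSet G E i = largeSet G E (i + 1) ∪ slice G E i := by
  rw [slice, Set.union_sdiff_cancel (largeSet_antitone (Nat.le_succ i))]

/-- `G_i` is the union of `G_{i+1}` and `S_i`, and a maximum over a union splits. For vertices of
`G_ℓ` the set `G_ℓ` is removed, which leaves `S_i` intact. -/
lemma target_of_lt [Finite V] {i : ℕ} (hi : i < ℓ) {u : V}
    (hu : i < sliceIndex G E ℓ u) : target G ω E ℓ i u =
      max (target G ω E ℓ (i + 1) u) (setEcc G (slice G E i) ω u) := by
  rw [target, target, if_pos hu.le, if_pos (Nat.succ_le_of_lt hu), ← setEcc_union]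
  have hunion := largeSet_eq_union (G := G) (E := E) i
  congr 1
  split_ifs
  · exact hunion
  · rw [hunion, Set.union_sdiff_distrib]
    congr 1
    rw [sdiff_eq_left, Set.disjoint_left]
    exact fun x hx hxl => hx.2 (largeSet_antitone hi hxl)

/-- No slice has been taken into account yet and the supremum over the empty set is `0`, so the zero
output array is the right start. -/
lemma target_ell (u : V) : target G ω E ℓ ℓ u = 0 := by
  rw [target]
  split_ifs with h1 h2
  · omega
  · rw [Set.sdiff_self]
    exact Nat.le_zero.1 (setEcc_le fun z hz => absurd hz (Set.notMem_empty z))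
  · rfl

/-- The number of edges of an induced subgraph. -/
lemma ncard_edgeSet_le [Finite V] {U : Type*} {H : SimpleGraph U} (ι : H ↪g G) : H.edgeSet.ncard ≤ G.edgeSet.ncard := by
  rw [← Nat.card_coe_set_eq, ← Nat.card_coe_set_eq]
  exact Nat.card_le_card_of_injective _ ι.mapEdgeSet.injective

/-- The data on which the program for one slice operates, outside the output array. -/
structure InMemory (G : SimpleGraph V) (E : ℕ → Set (Sym2 V)) (ℓ : ℕ)
    {U : Type*} {H : SimpleGraph U} (ι : H ↪g G)
    (A : AdjLists H) (e e' : U → ℕ) (s : State) : Prop where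
  reg_zero : s.reg 0 = A.size
  mem_one : s.mem 1 = A.off
  mem_two : s.mem 2 = A.nb
  mem_four : s.mem 4 = A.vertexArray fun u => sliceIndex G E ℓ (ι u)
  mem_five : s.mem 5 = A.vertexArray e
  mem_six : s.mem 6 = A.vertexArray e'

/-! ### The recursion in the setting of the theorem, and bounds for its values -/

namespace SliceSetting

variable [Fintype V] {v₀ umax : V}

lemma label_eq_target (h : SliceSetting G ω v₀ umax E ℓ) {i : ℕ} (hi : i ≤ ℓ) {u : V}
    (hu : sliceIndex G E ℓ u < ℓ) : label G ω E ℓ i u = target G ω E ℓ i u := by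
  rw [label, target, mem_labelDomain_iff]
  by_cases hiu : i ≤ sliceIndex G E ℓ u
  · rw [if_pos ⟨hiu, hu⟩, if_pos hiu, if_pos hu,
      weccOn_eq_setEcc h.isMedianGraph.1 (h.largeSet_convex hi) ω ((mem_largeSet_iff hi u).2 hiu)]
  · rw [if_neg (fun h => hiu h.1), if_neg hiu]

lemma weccOn_slice (h : SliceSetting G ω v₀ umax E ℓ) {i : ℕ} (hi : i < ℓ) (ω' : V → ℕ) {u : V}
    (hu : sliceIndex G E ℓ u = i) :
    weccOn G (slice G E i) ω' u = setEcc G (slice G E i) ω' u :=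
  weccOn_eq_setEcc h.isMedianGraph.1 (h.slice_convex hi) ω' ((mem_slice_iff hi u).2 hu)

lemma target_of_eq (h : SliceSetting G ω v₀ umax E ℓ) {i : ℕ} (hi : i < ℓ) {u : V}
    (hu : sliceIndex G E ℓ u = i) : target G ω E ℓ i u =
      max (weccOn G (slice G E i) (sliceWeight G ω E i) u) (setEcc G (slice G E i) ω u) := by
  rw [target, if_pos hu.ge, if_pos (by omega), h.weccOn_slice hi _ hu, max_comm]
  refine h.isMedianGraph.setEcc_eq_max_fiberWeight (slice_subset_largeSet i) (h.slice_convex hi)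
    (h.largeSet_convex hi.le) ω _ (fun x hx => ?_) ((mem_slice_iff hi u).2 hu)
  rw [sliceWeight, dif_pos hx]

/-- Leaving out `G_ℓ` loses nothing for its own vertices, since the first slice contains a vertex
farthest from each of them. -/
lemma target_zero (h : SliceSetting G ω v₀ umax E ℓ) (u : V) :
    target G ω E ℓ 0 u = wecc G ω u := by
  rw [target, if_pos (Nat.zero_le _)]
  split_ifs with hu
  · exact setEcc_univ ω u
  · apply le_antisymm
    · rw [← setEcc_univ]
      exact setEcc_mono (Set.subset_univ _) ω u
    · rw [← h.setEcc_slice_zero ((mem_largeSet_iff le_rfl u).2 (not_lt.1 hu))]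
      exact setEcc_mono (Set.sdiff_subset_sdiff_right (largeSet_antitone h.ell_pos)) ω u

lemma setEcc_le_magnitude (h : SliceSetting G ω v₀ umax E ℓ) (C : Set V) (u : V) :
    setEcc G C ω u ≤ inputMagnitude G ω := by
  have := setEcc_le_card_add h.isMedianGraph.1 C ω u
  rw [inputMagnitude]
  omega

lemma target_le_magnitude (h : SliceSetting G ω v₀ umax E ℓ) (i : ℕ) (u : V) :
    target G ω E ℓ i u ≤ inputMagnitude G ω := by
  rw [target]
  split_ifs
  · exact h.setEcc_le_magnitude _ u
  · exact h.setEcc_le_magnitude _ u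
  · exact Nat.zero_le _

lemma weccOn_slice_le_magnitude (h : SliceSetting G ω v₀ umax E ℓ) {i : ℕ} (hi : i < ℓ) (u : V) :
    weccOn G (slice G E i) ω u ≤ inputMagnitude G ω := by
  by_cases hu : sliceIndex G E ℓ u = i
  · rw [h.weccOn_slice hi ω hu]
    exact h.setEcc_le_magnitude _ u
  · rw [weccOn, dif_neg (fun hm => hu ((mem_slice_iff hi u).1 hm))]
    exact Nat.zero_le _

/-- The weight `ω_i^*` need not be bounded by the maximum of `ω`, but this eccentricity is one of
the two terms of `target`, a weighted distance for `ω`. -/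
lemma weccOn_sliceWeight_le_magnitude (h : SliceSetting G ω v₀ umax E ℓ) {i : ℕ} (hi : i < ℓ)
    (u : V) : weccOn G (slice G E i) (sliceWeight G ω E i) u ≤ inputMagnitude G ω := by
  by_cases hu : sliceIndex G E ℓ u = i
  · exact le_trans (by rw [h.target_of_eq hi hu]; exact le_max_left _ _)
      (h.target_le_magnitude i u)
  · rw [weccOn, dif_neg (fun hm => hu ((mem_slice_iff hi u).1 hm))]
    exact Nat.zero_le _

lemma ell_le_card (h : SliceSetting G ω v₀ umax E ℓ) : ℓ ≤ Nat.card V :=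
  Nat.lt_two_pow_self.le.trans h.two_pow_le

/-! ## The search in the memory -/

variable {U : Type*} {H : SimpleGraph U}

/-- The data of the search from the slice of index `i`, in a subgraph `H` that contains `G_i`. -/
noncomputable def searchData (h : SliceSetting G ω v₀ umax E ℓ) {i : ℕ} (hi : i < ℓ)
    (ι : H ↪g G) (hι : largeSet G E i ⊆ Set.range ι) (A : AdjLists H) (e : U → ℕ)
    (he : ∀ u, sliceIndex G E ℓ (ι u) = i → e u = weccOn G (slice G E i) ω (ι u)) :
    SearchData where
  n := A.size
  i := i
  off := A.off
  nb := A.nb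
  sl := A.vertexArray fun u => sliceIndex G E ℓ (ι u)
  ecc := A.vertexArray e
  D := A.vertexArray fun u => setDist G (slice G E i) (ι u)
  F := A.vertexArray fun u => setEcc G (slice G E i) ω (ι u)
  off_zero := by simp [AdjLists.off]
  off_le p hp := by
    obtain ⟨v, rfl⟩ := A.exists_num hp
    rw [A.off_succ]
    omega
  nb_lt p hp k h1 h2 := by
    obtain ⟨v, rfl⟩ := A.exists_num hp
    obtain ⟨w, -, hw⟩ := A.exists_nb h1 h2
    rw [hw]
    exact (A.num w).2
  D_zero p hp hr := by
    obtain ⟨v, rfl⟩ := A.exists_num hp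
    obtain ⟨w, hw, -⟩ := h.exists_mem_slice hi
    simp only [A.vertexArray_num]
    rw [setDist_eq_zero h.isMedianGraph.1 ⟨w, hw⟩, mem_slice_iff hi]
  D_le p hp hr k h1 h2 hr' := by
    obtain ⟨v, rfl⟩ := A.exists_num hp
    obtain ⟨w, hadj, hw⟩ := A.exists_nb h1 h2
    obtain ⟨x, hx, -⟩ := h.exists_mem_slice hi
    simp only [hw, A.vertexArray_num]
    exact setDist_le_succ_of_adj h.isMedianGraph.1 ⟨x, hx⟩ (ι.map_adj_iff.2 hadj)
  D_pred p hp hr d hd := by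
    obtain ⟨v, rfl⟩ := A.exists_num hp
    obtain ⟨x, hx, -⟩ := h.exists_mem_slice hi
    simp only [A.vertexArray_num] at hr hd
    obtain ⟨y, hy, hvy, hyd⟩ := exists_adj_setDist h.isMedianGraph.1 (slice_subset_largeSet i)
      (h.largeSet_convex hi.le) ⟨x, hx⟩ ((mem_largeSet_iff hi.le _).2 hr) hd
    -- By convexity the predecessor is in `G_i`, hence a vertex of `H`.
    obtain ⟨w, rfl⟩ := hι hy
    obtain ⟨k, hk1, hk2, hk⟩ := A.exists_off (ι.map_adj_iff.1 hvy.symm)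
    refine ⟨A.num w, (A.num w).2, ?_, ?_, k, hk1, hk2, hk⟩
    · rw [A.vertexArray_num]
      exact (mem_largeSet_iff hi.le _).1 hy
    · rw [A.vertexArray_num, hyd]
  F_source p hp hs := by
    obtain ⟨v, rfl⟩ := A.exists_num hp
    simp only [A.vertexArray_num] at hs ⊢
    rw [he v hs, h.weccOn_slice hi ω hs]
  F_succ p hp hr k h1 h2 hr' hD := by
    obtain ⟨v, rfl⟩ := A.exists_num hp
    obtain ⟨w, hadj, hw⟩ := A.exists_nb h1 h2
    obtain ⟨x, hx, -⟩ := h.exists_mem_slice hi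
    simp only [hw, A.vertexArray_num] at hD ⊢
    exact h.isMedianGraph.setEcc_succ (h.slice_convex hi) ⟨x, hx⟩ ω (ι.map_adj_iff.2 hadj) hD

/-- Correctness of the program for one slice. -/
theorem runs_stepProgram (h : SliceSetting G ω v₀ umax E ℓ) {i : ℕ} (hi : i < ℓ) {ι : H ↪g G}
    (hι : largeSet G E i ⊆ Set.range ι) {A : AdjLists H} {e e' : U → ℕ}
    (he : ∀ u, sliceIndex G E ℓ (ι u) = i → e u = weccOn G (slice G E i) ω (ι u))
    (he' : ∀ u, sliceIndex G E ℓ (ι u) = i →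
      e' u = weccOn G (slice G E i) (sliceWeight G ω E i) (ι u))
    {W : ℕ} (hW : 2 * inputMagnitude G ω ≤ W)
    (hle : ∀ u, e u ≤ inputMagnitude G ω) (hle' : ∀ u, e' u ≤ inputMagnitude G ω)
    {s : State} (hs : InMemory G E ℓ ι A e e' s) (hi1 : s.reg 1 = i)
    (hout : ∀ u, s.mem 0 (A.num u) ≤ inputMagnitude G ω) :
    Runs W stepProgram s (fun t s' =>
      InMemory G E ℓ ι A e e' s' ∧ s'.reg 1 = i ∧ s'.reg 3 = 1 ∧ s'.reg 4 = 0 ∧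
      (∀ u, sliceIndex G E ℓ (ι u) < i → s'.mem 0 (A.num u) = s.mem 0 (A.num u)) ∧
      (∀ u, i ≤ sliceIndex G E ℓ (ι u) →
        (i < sliceIndex G E ℓ (ι u) → s.mem 0 (A.num u) = target G ω E ℓ (i + 1) (ι u)) →
        s'.mem 0 (A.num u) = target G ω E ℓ i (ι u)) ∧
      t ≤ 32 * (A.size + A.off A.size + 1)) := by
  have hfin : Finite U := Finite.of_injective ι ι.injective
  have hcard : A.size ≤ Nat.card V :=
    A.size_eq.trans_le (Nat.card_le_card_of_injective ι ι.injective)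
  have h3 := h.three_le
  have hmag : Nat.card V + G.edgeSet.ncard ≤ inputMagnitude G ω := Nat.le_add_right _ _
  have hedge := ncard_edgeSet_le ι
  have hoff := A.off_size_eq_two_mul
  set S := h.searchData hi ι hι A e he with hS
  have hB : S.Bounded (A.vertexArray e') (s.mem 0) W := by
    constructor
    · change A.size < W
      omega
    · change A.off A.size ≤ W
      omega
    · intro p hp
      obtain ⟨v, rfl⟩ := A.exists_num hp
      rw [show S.sl (A.num v) = sliceIndex G E ℓ (ι v) from
        A.vertexArray_num (fun u => sliceIndex G E ℓ (ι u)) v]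
      have h1 := sliceIndex_le (G := G) (E := E) (ℓ := ℓ) (ι v)
      have h2 := h.ell_le_card
      omega
    · intro p hp
      obtain ⟨v, rfl⟩ := A.exists_num hp
      rw [show S.ecc (A.num v) = e v from A.vertexArray_num _ v]
      have := hle v
      omega
    · intro p hp
      obtain ⟨v, rfl⟩ := A.exists_num hp
      rw [A.vertexArray_num]
      have := hle' v
      omega
    · intro p hp
      obtain ⟨v, rfl⟩ := A.exists_num hp
      have := hout v
      omega
    · intro p hp _
      obtain ⟨v, rfl⟩ := A.exists_num hp
      rw [show S.F (A.num v) = setEcc G (slice G E i) ω (ι v) from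
        A.vertexArray_num (fun u => setEcc G (slice G E i) ω (ι u)) v]
      have := h.setEcc_le_magnitude (slice G E i) (ι v)
      omega
  refine (SearchData.runs_stepProgram hB ⟨hs.reg_zero, hi1, hs.mem_one, hs.mem_two, hs.mem_four,
    hs.mem_five, hs.mem_six⟩ rfl).mono ?_
  rintro t s' ⟨hF, hmem, ht⟩
  have hval : ∀ u, s'.mem 0 (A.num u) = if i ≤ sliceIndex G E ℓ (ι u) then
      max (if sliceIndex G E ℓ (ι u) = i then e' u else s.mem 0 (A.num u))
        (setEcc G (slice G E i) ω (ι u)) else s.mem 0 (A.num u) := by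
    intro u
    rw [hmem _ (A.num u).2, SearchData.stepOut]
    simp only [hS, searchData, A.vertexArray_num]
  refine ⟨⟨hF.reg_zero, hF.mem_one, hF.mem_two, hF.mem_four, hF.mem_five, hF.mem_six⟩,
    hF.reg_one, hF.reg_three, hF.reg_four, ?_, ?_, ht⟩
  · intro u hu
    rw [hval, if_neg (not_le.2 hu)]
  · intro u hu hnext
    rw [hval, if_pos hu]
    split_ifs with heq
    · rw [h.target_of_eq hi heq, he' u heq]
    · have hlt := lt_of_le_of_ne hu (Ne.symm heq)
      rw [target_of_lt hi hlt, hnext hlt]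

end SliceSetting

/-! ## The programs -/

/-- Copies array `7` to the output array. -/
def copyProgram : Program := .block
  [.instr (.const 3 1),
   .instr (.const 5 0),
   .loop (.lt 5 0) (.block
     [.instr (.load 9 7 5),
      .instr (.store 0 5 9),
      .instr (.add 5 5 3)])]

lemma runs_copyProgram {W n : ℕ} {s : State} (hn : s.reg 0 = n) (hW : n < W)
    (hle : ∀ p < n, s.mem 7 p ≤ W) : Runs W copyProgram s (fun t s' =>
      t ≤ 8 * (n + 1) ∧ s'.reg 0 = n ∧ s'.reg 1 = s.reg 1 ∧
      (∀ a, a ≠ 0 → s'.mem a = s.mem a) ∧ ∀ p < n, s'.mem 0 p = s.mem 7 p) := by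
  simp only [copyProgram, runs_block_cons, runs_instr, Instr.value, Instr.run]
  refine ⟨by omega, by omega, ?_⟩
  refine Runs.loop (fun s' => s'.reg 0 = n ∧ s'.reg 1 = s.reg 1 ∧ s'.reg 3 = 1 ∧ s'.reg 5 ≤ n ∧
    (∀ a, a ≠ 0 → s'.mem a = s.mem a) ∧ ∀ p < s'.reg 5, s'.mem 0 p = s.mem 7 p)
    (fun s' => 5 * (n - s'.reg 5)) ?_ ?_ ?_
  · simp [hn]
  · rintro s' ⟨h0, h1, h3, h5, hm, h⟩ hb
    simp only [Test.holds, h0] at hb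
    have h7 := hm 7 (by decide)
    have hp := hle _ hb
    simp [runs_block_cons, runs_block_nil, runs_instr, Instr.value, Instr.run, h0, h1, h3, h7]
    refine ⟨hp, by omega, ⟨by omega, ?_, ?_⟩, by omega⟩
    · intro a ha
      rw [Function.update_of_ne ha, hm a ha]
    · intro p hp'
      rcases Nat.lt_or_eq_of_le hp' with h' | rfl
      · rw [Function.update_of_ne h'.ne, h p h']
      · rw [Function.update_self]
  · rintro t s' ⟨h0, h1, h3, h5, hm, h⟩ hb ht
    simp only [Test.holds, h0] at hb
    rw [runs_block_nil]
    simp at ht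
    exact ⟨by omega, h0, h1, hm, fun p hp => h p (by omega)⟩

/-- The program for one slice, which starts from the labels in array `7`. -/
def labelProgram : Program := .block [copyProgram, stepProgram]

/-- The program for all slices; register `1` holds their number. -/
def eccProgram : Program := .block
  [.instr (.const 3 1),
   .instr (.const 4 0),
   .loop (.lt 4 1) (.block [.instr (.sub 1 1 3), stepProgram])]

/-! ### Correctness and total time of the two programs -/

namespace SliceSetting

variable [Fintype V] {v₀ umax : V}

theorem runs_labelProgram (h : SliceSetting G ω v₀ umax E ℓ) {i : ℕ} (hi : i < ℓ)
    (A : AdjLists (G.induce (largeSet G E i))) {W : ℕ} (hW : 2 * inputMagnitude G ω ≤ W) :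
    Runs W labelProgram (stepInput G ω E ℓ i A) (fun t s =>
      t ≤ 320 * (G.induce (largeSet G E i)).edgeSet.ncard ∧
      ∀ u : largeSet G E i, u.1 ∈ labelDomain G E ℓ i →
        s.mem 0 (A.num u) = label G ω E ℓ i u) := by
  have hG := h.isMedianGraph
  have hcard : A.size ≤ Nat.card V :=
    A.size_eq.trans_le (Nat.card_le_card_of_injective _ Subtype.val_injective)
  have h3 := h.three_le
  have hmag : Nat.card V ≤ inputMagnitude G ω := by
    rw [inputMagnitude]
    omega
  have hlabel : ∀ j ≤ ℓ, ∀ u, label G ω E ℓ j u ≤ inputMagnitude G ω := by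
    intro j hj u
    by_cases hu : sliceIndex G E ℓ u < ℓ
    · rw [h.label_eq_target hj hu]
      exact h.target_le_magnitude j u
    · rw [label, if_neg (fun hm => hu ((mem_labelDomain_iff j u).1 hm).2)]
      exact Nat.zero_le _
  -- A connected graph has at most one vertex more than edges, and the edge from `v₀` into the slice
  -- provides at least one edge, so additive constants are absorbed.
  have hedges : A.size + 1 ≤ 3 * (G.induce (largeSet G E i)).edgeSet.ncard := by
    have hconn : (G.induce (largeSet G E i)).Connected :=
      { preconnected := fun a b =>
          ((h.largeSet_convex hi.le).induce_connected_dist hG.1 a b).1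
        nonempty := ⟨⟨v₀, h.center_mem_largeSet hi.le⟩⟩ }
    have h1 := hconn.card_vert_le_card_edgeSet_add_one
    obtain ⟨w, hw, hadj⟩ := h.exists_mem_slice hi
    have h2 : 0 < (G.induce (largeSet G E i)).edgeSet.ncard := (Set.ncard_pos).2
      ⟨s(⟨v₀, h.center_mem_largeSet hi.le⟩, ⟨w, slice_subset_largeSet i hw⟩), hadj⟩
    rw [← A.size_eq, Nat.card_coe_set_eq] at h1
    omega
  rw [labelProgram, runs_block_cons]
  refine (runs_copyProgram (n := A.size) rfl (by omega) ?_).mono ?_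
  · intro p hp
    obtain ⟨u, rfl⟩ := A.exists_num hp
    refine le_trans (le_of_eq (A.vertexArray_num (fun v => label G ω E ℓ (i + 1) v) u)) ?_
    have := hlabel (i + 1) hi u
    omega
  rintro t₁ s₁ ⟨ht₁, h0, h1, hm, hout⟩
  have hout' : ∀ u : largeSet G E i, s₁.mem 0 (A.num u) = label G ω E ℓ (i + 1) u := by
    intro u
    rw [hout _ (A.num u).2]
    exact A.vertexArray_num (fun v => label G ω E ℓ (i + 1) v) u
  rw [runs_block_cons]
  refine (h.runs_stepProgram hi (ι := SimpleGraph.Embedding.induce _) (A := A)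
    (e := fun u => weccOn G (slice G E i) ω u)
    (e' := fun u => weccOn G (slice G E i) (sliceWeight G ω E i) u) ?_ (fun _ _ => rfl)
    (fun _ _ => rfl) hW (fun u => h.weccOn_slice_le_magnitude hi u)
    (fun u => h.weccOn_sliceWeight_le_magnitude hi u)
    ⟨h0, hm 1 (by decide), hm 2 (by decide), hm 4 (by decide), hm 5 (by decide),
      hm 6 (by decide)⟩ h1 (fun u => (hout' u).trans_le (hlabel (i + 1) hi u))).mono ?_
  · exact fun x hx => ⟨⟨x, hx⟩, rfl⟩
  rintro t₂ s₂ ⟨-, -, -, -, -, hres, ht₂⟩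
  rw [runs_block_nil]
  have hoff := A.off_size_eq_two_mul
  refine ⟨by omega, ?_⟩
  intro u hu
  obtain ⟨hiu, hul⟩ := (mem_labelDomain_iff i u.1).1 hu
  rw [h.label_eq_target hi.le hul]
  -- Only the old value at `u` itself matters, so the zeros that the labeling has on `G_ℓ` do no
  -- harm.
  refine hres u hiu fun _ => ?_
  rw [hout' u, h.label_eq_target hi hul]
  rfl

/-- With `i` in register `1`, the output is `target` at `i`. Every pass runs over the lists of all
of `G`, and earlier slices are kept out by their marks; hence the same time bound for each of the
`ℓ` passes. -/
theorem runs_eccProgram (h : SliceSetting G ω v₀ umax E ℓ) (A : AdjLists G) {W : ℕ}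
    (hW : 2 * inputMagnitude G ω ≤ W) :
    Runs W eccProgram (slicesInput G ω E ℓ A) (fun t s =>
      t ≤ ℓ * (32 * (A.size + A.off A.size + 1) + 4) + 4 ∧
      ∀ u, s.mem 0 (A.num u) = wecc G ω u) := by
  have h3 := h.three_le
  have hℓ := h.ell_le_card
  have hmag : Nat.card V ≤ inputMagnitude G ω := by
    rw [inputMagnitude]
    omega
  set K := 32 * (A.size + A.off A.size + 1) + 4 with hK
  set e : V → ℕ := fun v => if sliceIndex G E ℓ v < ℓ then
    weccOn G (slice G E (sliceIndex G E ℓ v)) ω v else 0 with he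
  set e' : V → ℕ := fun v => if sliceIndex G E ℓ v < ℓ then
    weccOn G (slice G E (sliceIndex G E ℓ v)) (sliceWeight G ω E (sliceIndex G E ℓ v)) v
      else 0 with he'
  simp only [eccProgram, runs_block_cons, runs_instr, Instr.value, Instr.run]
  refine ⟨by omega, by omega, ?_⟩
  refine Runs.loop (fun s => InMemory G E ℓ (SimpleGraph.Embedding.refl (G := G)) A e e' s ∧
    s.reg 1 ≤ ℓ ∧ s.reg 3 = 1 ∧ s.reg 4 = 0 ∧
    ∀ u, s.mem 0 (A.num u) = target G ω E ℓ (s.reg 1) u) (fun s => K * s.reg 1) ?_ ?_ ?_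
  · refine ⟨⟨?_, rfl, rfl, rfl, rfl, rfl⟩, ?_, ?_, ?_, ?_⟩
    · simp [slicesInput, AdjLists.initial]
    · simp [slicesInput, AdjLists.initial]
    · simp
    · simp
    · intro u
      simp [slicesInput, AdjLists.initial, target_ell]
  · rintro s ⟨hin, hle, hr3, hr4, hmem⟩ hb
    simp only [Test.holds, hr4] at hb
    obtain ⟨i, hi⟩ := Nat.exists_eq_succ_of_ne_zero hb.ne'
    rw [hi] at hmem hle
    simp only [runs_block_cons, runs_instr, Instr.value, Instr.run, hr3, hi, Nat.succ_sub_one]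
    refine ⟨by omega, ?_⟩
    refine (h.runs_stepProgram (i := i) (by omega) (ι := SimpleGraph.Embedding.refl (G := G))
      (A := A) (e := e) (e' := e') (fun x _ => ⟨x, rfl⟩) ?_ ?_ hW ?_ ?_ ?_ ?_ ?_).mono ?_
    · intro u hu
      change sliceIndex G E ℓ u = i at hu
      simp only [he, hu]
      rw [if_pos (by omega)]
      rfl
    · intro u hu
      change sliceIndex G E ℓ u = i at hu
      simp only [he', hu]
      rw [if_pos (by omega)]
      rfl
    · intro u
      simp only [he]
      split_ifs with hu
      · exact h.weccOn_slice_le_magnitude hu u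
      · exact Nat.zero_le _
    · intro u
      simp only [he']
      split_ifs with hu
      · exact h.weccOn_sliceWeight_le_magnitude hu u
      · exact Nat.zero_le _
    · exact ⟨by simpa using hin.reg_zero, hin.mem_one, hin.mem_two, hin.mem_four, hin.mem_five,
        hin.mem_six⟩
    · simp
    · intro u
      exact (hmem u).trans_le (h.target_le_magnitude _ u)
    · rintro t s' ⟨hin', hr1', hr3', hr4', hlow, hres, ht⟩
      rw [runs_block_nil]
      refine ⟨⟨hin', by omega, hr3', hr4', fun u => ?_⟩, ?_⟩
      · rw [hr1']
        by_cases hu : i ≤ sliceIndex G E ℓ u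
        · exact hres u hu fun _ => hmem u
        -- Outside `G_i` the cell is untouched and both targets are `0`.
        · refine (hlow u (not_le.1 hu)).trans ((hmem u).trans ?_)
          rw [target, target, if_neg (by omega), if_neg hu]
      · rw [hr1', Nat.mul_succ]
        omega
  · rintro t s ⟨-, -, -, hr4, hmem⟩ hb ht
    simp only [Test.holds, hr4, not_lt, Nat.le_zero] at hb
    rw [runs_block_nil]
    constructor
    · have : K * ℓ = ℓ * K := mul_comm _ _
      simp [slicesInput, AdjLists.initial] at ht
      omega
    · intro u
      rw [hmem, hb, h.target_zero]

lemma eccTime_le (h : SliceSetting G ω v₀ umax E ℓ) (A : AdjLists G) :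
    ((ℓ * (32 * (A.size + A.off A.size + 1) + 4) + 4 : ℕ) : ℝ) ≤
      1000 * (Nat.card V * Real.log (Nat.card V) ^ 2) := by
  have h3 := h.three_le
  have hℓ : ℓ ≤ Nat.log 2 (Nat.card V) := Nat.le_log_of_pow_le one_lt_two h.two_pow_le
  have hoff := A.off_size_le h.isMedianGraph
  rw [A.size_eq] at hoff ⊢
  set n := Nat.card V
  set L := Nat.log 2 n
  have hL1 : 1 ≤ L := Nat.log_pos one_lt_two (by omega)
  have hnL : n ≤ n * L := Nat.le_mul_of_pos_right n hL1
  have h1 : ℓ * (32 * (n + A.off n + 1) + 4) + 4 ≤ 200 * (n * L ^ 2) := by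
    have e1 : 32 * (n + A.off n + 1) + 4 ≤ 132 * (n * L) := by omega
    have e2 : 4 ≤ 4 * (n * L ^ 2) := Nat.le_mul_of_pos_right 4 (by positivity)
    calc ℓ * (32 * (n + A.off n + 1) + 4) + 4 ≤ L * (132 * (n * L)) + 4 * (n * L ^ 2) :=
          Nat.add_le_add (Nat.mul_le_mul hℓ e1) e2
      _ = 136 * (n * L ^ 2) := by ring
      _ ≤ _ := Nat.mul_le_mul_right _ (by norm_num)
  -- The factor two comes from `log 2 > 1 / 2`.
  have hlog : (L : ℝ) ≤ 2 * Real.log n := by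
    have h2 : (2 : ℝ) ^ L ≤ n := by exact_mod_cast Nat.pow_log_le_self 2 (by omega)
    have h4 := Real.log_le_log (by positivity) h2
    rw [Real.log_pow] at h4
    nlinarith [Real.log_two_gt_d9, Nat.cast_nonneg (α := ℝ) L]
  calc ((ℓ * (32 * (n + A.off n + 1) + 4) + 4 : ℕ) : ℝ) ≤ ((200 * (n * L ^ 2) : ℕ) : ℝ) := by
        exact_mod_cast h1
    _ = 200 * (n * (L : ℝ) ^ 2) := by push_cast; ring
    _ ≤ 200 * (n * (2 * Real.log n) ^ 2) := by gcongr
    _ ≤ 1000 * (n * Real.log n ^ 2) := by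
        have : 0 ≤ (n : ℝ) * Real.log n ^ 2 := by positivity
        linarith

end SliceSetting

end MedianEcc

theorem mainTheorem5 :
    (∃ (P : MedianEcc.Program) (C : ℕ),
      ∀ (V : Type*) [Fintype V] (G : SimpleGraph V) (ω : V → ℕ) (v₀ umax : V)
        (E : ℕ → Set (Sym2 V)) (ℓ : ℕ), MedianEcc.SliceSetting G ω v₀ umax E ℓ →
      ∀ (i : ℕ), i < ℓ →
      ∀ A : MedianEcc.AdjLists (G.induce (MedianEcc.largeSet G E i)),
      ∃ (t : ℕ) (s : MedianEcc.State),
        MedianEcc.Exec (C * MedianEcc.inputMagnitude G ω) P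
          (MedianEcc.stepInput G ω E ℓ i A) t s ∧
        t ≤ C * (G.induce (MedianEcc.largeSet G E i)).edgeSet.ncard ∧
        ∀ u : MedianEcc.largeSet G E i, u.1 ∈ MedianEcc.labelDomain G E ℓ i →
          s.mem 0 (A.num u) = MedianEcc.label G ω E ℓ i u) ∧
    (∃ (P : MedianEcc.Program) (C : ℕ),
      ∀ (V : Type*) [Fintype V] (G : SimpleGraph V) (ω : V → ℕ) (v₀ umax : V)
        (E : ℕ → Set (Sym2 V)) (ℓ : ℕ), MedianEcc.SliceSetting G ω v₀ umax E ℓ →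
      ∀ A : MedianEcc.AdjLists G,
      ∃ (t : ℕ) (s : MedianEcc.State),
        MedianEcc.Exec (C * MedianEcc.inputMagnitude G ω) P
          (MedianEcc.slicesInput G ω E ℓ A) t s ∧
        (t : ℝ) ≤ C * (Nat.card V * Real.log (Nat.card V) ^ 2) ∧
        ∀ u : V, s.mem 0 (A.num u) = MedianEcc.wecc G ω u) := by
  refine ⟨⟨MedianEcc.labelProgram, 320, ?_⟩, ⟨MedianEcc.eccProgram, 1000, ?_⟩⟩
  · intro V _ G ω v₀ umax E ℓ h i hi A
    exact h.runs_labelProgram hi A (Nat.mul_le_mul_right _ (by norm_num))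
  · intro V _ G ω v₀ umax E ℓ h A
    obtain ⟨t, s, hexec, ht, hs⟩ := h.runs_eccProgram A
      (W := 1000 * MedianEcc.inputMagnitude G ω) (Nat.mul_le_mul_right _ (by norm_num))
    refine ⟨t, s, hexec, ?_, hs⟩
    have h1 := h.eccTime_le A
    push_cast
    exact le_trans (by exact_mod_cast ht) h1
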